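/- **Setting.** Let $\mathbb S^2$ be the unit sphere with geodesic distance, closed geodesic balls $B(\mathbf y,r)$, surface measure $\lambda$, north pole $\mathbf o$, and for every $\mathbf y\in\mathbb S^2$ let $O_{\mathbf y}$ be a rotation matrix with $O_{\mathbf y}\mathbf o=\mathbf y$. Let $\mathcal M$ be a Polish space (with a fixed complete metric) with a $\sigma$-finite Borel reference measure $\nu$, and let $X$ be a (simple, locally finite) marked point process on $\mathbb S^2$ with marks in $\mathcal M$. Assume that for every $n\ge 1$ the $n$-th order intensity function $\rho^{(n)}$ exists, i.e. $\rho^{(n)}:(\mathbb S^2\times\mathcal M)^n\to[0,\infty)$ is a density of the $n$-th factorial moment measure of $X$ with respect to $(\lambda\otimes\nu)^n$; write $\rho=\rho^{(1)}$. For $E\subset\mathcal M$ put $\bar\rho_E=\inf_{\mathbf x\in\mathbb S^2,m\in E}\rho(\mathbf x,m)$. The correlation functions $\xi_n$ are defined by $\xi_1=1$ and, for $n\ge2$, $$\sum_{\pi}\prod_{A\in\pi}\xi_{|A|}(z_i:i\in A)=\frac{\rho^{(n)}(z_1,\dots,z_n)}{\rho(z_1)\cdots\rho(z_n)},$$ the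 sum being over all partitions $\pi$ of $\{1,\dots,n\}$ into nonempty blocks. Assume that $X$ is intensity-reweighted momented isotropic (IRWMI): $\bar\rho_{\mathcal M}>0$ and, for all $n\ge1$, all points $(\mathbf x_i,m_i)$ and all rotation matrices $O$, $\xi_n((O\mathbf x_1,m_1),\dots,(O\mathbf x_n,m_n))=\xi_n((\mathbf x_1,m_1),\dots,(\mathbf x_n,m_n))$. Let $P^!_{(\mathbf x,m)}$ be a version of the reduced Palm distributions of $X$, with expectations $\mathbb E^!_{(\mathbf x,m)}$. Let $C,E\subset\mathcal M$ be Borel sets with $0<\nu(C)<\infty$. **Definitions.** For $\mathbf y\in\mathbb S^2$ and $r\in[0,\pi]$ let $u^r_{\mathbf y,E}(\mathbf x,m)=\bar\rho_E\,\mathbf 1\{(\mathbf x,m)\in B(\mathbf y,r)\times E\}/\rho(\mathbf x,m)$, $$F^E_{\rm inhom}(r)=1-\mathbb E\prod_{p\in X}\bigl(1-u^r_{\mathbf y,E}(p)\bigr),\qquad D^{CE}_{\rm inhom}(r)=1-\frac1{\nu(C)}\int_C\mathbb E^!_{(\mathbf y,a)}\Bigl[\prod_{p\in X}\bigl(1-u^r_{\mathbf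 y,E}(p)\bigr)\Bigr]\nu(da),$$ $$J_n^{CE}(r)=\int_C\int_{(B(\mathbf o,r)\times E)^n}\xi_{n+1}\bigl((\mathbf y,a),(O_{\mathbf y}\mathbf x_1,m_1),\dots,(O_{\mathbf y}\mathbf x_n,m_n)\bigr)\prod_{i=1}^n\lambda(d\mathbf x_i)\nu(dm_i)\,\nu(da),$$ $$J^{CE}_{\rm inhom}(r)=\frac1{\nu(C)}\Bigl\{\nu(C)+\sum_{n=1}^\infty\frac{(-\bar\rho_E)^n}{n!}J^{CE}_n(r)\Bigr\}.$$ We say that $J^{CE}_{\rm inhom}(r)$ is defined (with reference point $\mathbf y$) if all the integrals $J_n^{CE}(r)$, $n\ge1$, exist (as absolutely convergent integrals) and the series converges. Consider the root condition at $r$, $$\limsup_{n\to\infty}\left(\frac{\bar\rho_E^{\,n}}{n!}\int_{(B(\mathbf o,r)\times E)^n}\frac{\rho^{(n)}(z_1,\dots,z_n)}{\rho(z_1)\cdots\rho(z_n)}\,dz_1\cdots dz_n\right)^{1/n}<1,\tag{R}$$ where $dz_i$ refers to $\lambda\otimes\nu$. **Theorem.** There are functions $F,D,J:\mathbb R\to\mathbb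 R$, not depending on $\mathbf y$, such that the following holds. 1. For every $r\in[0,\pi]$ satisfying (R) and every $\mathbf y\in\mathbb S^2$, $F^E_{\rm inhom}(r)=F(r)$. 2. For every $r\in[0,\pi]$ such that $J^{CE}_{\rm inhom}(r)$ is defined with some reference point, it is defined with every reference point $\mathbf y$ and equals $J(r)$. 3. For $\lambda$-almost every $\mathbf y\in\mathbb S^2$, simultaneously for all $r\in[0,\pi]$ that satisfy (R) and for which $J^{CE}_{\rm inhom}(r)$ is defined or $$\sum_{n\ge1}\frac{\bar\rho_E^{\,n}}{n!}\int_C\int_{(B(\mathbf o,r)\times E)^n}\frac{\rho^{(n+1)}((\mathbf o,a),z_1,\dots,z_n)}{\rho(\mathbf o,a)\rho(z_1)\cdots\rho(z_n)}\,dz_1\cdots dz_n\,\nu(da)<\infty,$$ one has $D^{CE}_{\rm inhom}(r)=D(r)$. 4. For every $r\in[0,\pi]$ satisfying (R) for which $J^{CE}_{\rm inhom}(r)$ is defined and $F(r)\ne1$, $J(r)=\dfrac{1-D(r)}{1-F(r)}$. -/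

import Mathlib

open MeasureTheory ProbabilityTheory Filter Topology
open scoped NNReal ENNReal

namespace SphericalPP

noncomputable section

/-! ### The sphere, its rotations, balls and surface measure -/

/-- The unit sphere of three-dimensional Euclidean space. -/
abbrev S2 : Type := Metric.sphere (0 : EuclideanSpace ℝ (Fin 3)) 1

/-- The group of `3 × 3` rotation matrices. -/
abbrev Rot : Type := Matrix.specialOrthogonalGroup (Fin 3) ℝ

theorem norm_rotate (O : Rot) (x : EuclideanSpace ℝ (Fin 3)) :
    ‖WithLp.toLp 2 ((O : Matrix (Fin 3) (Fin 3) ℝ).mulVec x.ofLp)‖ = ‖x‖ := by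
  have hO : (O : Matrix (Fin 3) (Fin 3) ℝ).transpose * (O : Matrix (Fin 3) (Fin 3) ℝ) = 1 :=
    (Matrix.mem_orthogonalGroup_iff' (Fin 3) ℝ).1 (Matrix.mem_specialOrthogonalGroup_iff.1 O.2).1
  have key : ∀ v : EuclideanSpace ℝ (Fin 3), ‖v‖ ^ 2 = v.ofLp ⬝ᵥ v.ofLp := by
    intro v
    rw [EuclideanSpace.real_norm_sq_eq]
    simp [dotProduct, sq]
  refine (sq_eq_sq₀ (norm_nonneg _) (norm_nonneg _)).1 ?_
  rw [key, key, Matrix.dotProduct_mulVec, Matrix.vecMul_mulVec, hO, Matrix.vecMul_one]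

/-- The action `x ↦ O x` of a rotation matrix on the sphere. -/
def rotate (O : Rot) (x : S2) : S2 :=
  ⟨WithLp.toLp 2 ((O : Matrix (Fin 3) (Fin 3) ℝ).mulVec x.1.ofLp), by
    rw [mem_sphere_zero_iff_norm, norm_rotate]
    exact mem_sphere_zero_iff_norm.1 x.2⟩

/-- The north pole `(0, 0, 1)`. -/
def northPole : S2 := ⟨EuclideanSpace.single 2 1, by simp⟩

/-- The closed geodesic ball: the geodesic distance between two points of the unit sphere is the
angle between them. -/
def geoBall (y : S2) (r : ℝ) : Set S2 :=
  {x | InnerProductGeometry.angle (y : EuclideanSpace ℝ (Fin 3)) (x : EuclideanSpace ℝ (Fin 3)) ≤ r}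

/-- The surface (Lebesgue) measure on the sphere, of total mass `4π`. -/
def surf : Measure S2 := (volume : Measure (EuclideanSpace ℝ (Fin 3))).toSphere

/-! ### Locally finite configurations and sums over distinct points -/

section Config

variable (Y : Type*) [PseudoMetricSpace Y] [MeasurableSpace Y]

/-- Locally finite point configurations: sets of points with finitely many points in every
bounded Borel set. -/
def Config : Type _ :=
  {x : Set Y // ∀ A : Set Y, MeasurableSet A → Bornology.IsBounded A → (x ∩ A).Finite}

variable {Y}

/-- The underlying set of points of a configuration. -/
def Config.pts (x : Config Y) : Set Y := x.1

/-- The σ-algebra generated by the events that `A` contains exactly `n` points, for bounded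
Borel sets `A`. -/
instance : MeasurableSpace (Config Y) :=
  MeasurableSpace.generateFrom
    {S | ∃ (A : Set Y) (n : ℕ), MeasurableSet A ∧ Bornology.IsBounded A ∧
      S = {x : Config Y | (x.pts ∩ A).ncard = n}}

/-- The configuration `x ∖ {p}`. -/
def Config.erase (x : Config Y) (p : Y) : Config Y :=
  ⟨x.pts \ {p}, fun A hA hb =>
    (x.2 A hA hb).subset (Set.inter_subset_inter_left A Set.sdiff_subset)⟩

/-- `∑^{≠} f(x₁, …, xₙ)`, the sum over all `n`-tuples of pairwise distinct points of `x`. -/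
def distinctSum (x : Config Y) (n : ℕ) (f : (Fin n → Y) → ℝ≥0∞) : ℝ≥0∞ :=
  ∑' z : {z : Fin n → Y // Function.Injective z ∧ ∀ i, z i ∈ x.pts}, f z

/-- `∏_{p ∈ x} v(p)`. For `v` with values in `[0, 1]` this always converges. -/
def pointProd (x : Config Y) (v : Y → ℝ) : ℝ := ∏' p : x.pts, v p

end Config

/-! ### Intensity families and correlation functions -/

section Correlation

variable {Y : Type*}

/-- The first order intensity function `ρ(p) = ρ⁽¹⁾(p)` of a family `ρ⁽ⁿ⁾`. -/
def rho (ρ : (n : ℕ) → (Fin n → Y) → ℝ≥0) (p : Y) : ℝ≥0 := ρ 1 fun _ => p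

/-- `ρ⁽ⁿ⁾(z₁, …, zₙ) / (ρ(z₁) ⋯ ρ(zₙ))`. -/
def rhoRatio (ρ : (n : ℕ) → (Fin n → Y) → ℝ≥0) (n : ℕ) (z : Fin n → Y) : ℝ :=
  (ρ n z : ℝ) / ∏ i, (rho ρ (z i) : ℝ)

theorem card_block_lt {n : ℕ} (π : Finpartition (Finset.univ : Finset (Fin n)))
    (hπ : 1 < π.parts.card) {E : Finset (Fin n)} (hE : E ∈ π.parts) : E.card < n := by
  obtain ⟨F, hF, hne⟩ := Finset.exists_mem_ne hπ E
  have hdis : Disjoint F E := π.disjoint hF hE hne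
  obtain ⟨i, hi⟩ := π.nonempty_of_mem_parts hF
  have hss : E ⊂ Finset.univ :=
    Finset.ssubset_univ_iff.2 fun h =>
      Finset.disjoint_left.1 hdis hi (h ▸ Finset.mem_univ i)
  simpa using Finset.card_lt_card hss

/-- The `n`-th order correlation function `ξₙ`: `ξ₁ = 1`, and for `n ≥ 2` the sum over all
partitions of `{1, …, n}` of the products of `ξ_{|E|}(z_i : i ∈ E)` over the blocks `E` is
`ρ⁽ⁿ⁾(z₁, …, zₙ) / (ρ(z₁) ⋯ ρ(zₙ))`; the recursion solves this for the one-block term. -/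
def correlation (ρ : (n : ℕ) → (Fin n → Y) → ℝ≥0) (n : ℕ) (z : Fin n → Y) : ℝ :=
  if n = 1 then 1 else
    rhoRatio ρ n z -
      ∑ π : {π : Finpartition (Finset.univ : Finset (Fin n)) // 1 < π.parts.card},
        ∏ E : {E : Finset (Fin n) // E ∈ π.1.parts},
          correlation ρ E.1.card fun j => z (E.1.orderEmbOfFin rfl j)
termination_by n
decreasing_by exact card_block_lt π.1 π.2 E.2

/-- The defining equation of the correlation functions. -/
theorem sum_partitions_correlation (ρ : (n : ℕ) → (Fin n → Y) → ℝ≥0) {n : ℕ} (hn : 2 ≤ n)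
    (z : Fin n → Y) :
    ∑ π : Finpartition (Finset.univ : Finset (Fin n)),
      ∏ E : {E : Finset (Fin n) // E ∈ π.parts},
        correlation ρ E.1.card (fun j => z (E.1.orderEmbOfFin rfl j)) = rhoRatio ρ n z := by
  classical
  set g : Finpartition (Finset.univ : Finset (Fin n)) → ℝ := fun π =>
    ∏ E : {E : Finset (Fin n) // E ∈ π.parts},
      correlation ρ E.1.card (fun j => z (E.1.orderEmbOfFin rfl j)) with hg
  have hne : (Finset.univ : Finset (Fin n)) ≠ ⊥ := by
    intro h
    have := congrArg Finset.card h
    simp at this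
    omega
  set π₀ : Finpartition (Finset.univ : Finset (Fin n)) := Finpartition.indiscrete hne with hπ₀
  have hone : ∀ π : Finpartition (Finset.univ : Finset (Fin n)),
      ¬ 1 < π.parts.card ↔ π = π₀ := by
    intro π
    constructor
    · intro h
      have h1 : π.parts.card = 1 := by
        have := (π.parts_nonempty hne).card_pos
        omega
      obtain ⟨E, hE⟩ := Finset.card_eq_one.1 h1
      have hs := π.sup_parts
      rw [hE, Finset.sup_singleton, id] at hs
      apply Finpartition.ext
      rw [hE, hs]
      rfl
    · rintro rfl
      simp [hπ₀]
  have htop : g π₀ = correlation ρ n z := by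
    have hu : (Finset.univ : Finset {E : Finset (Fin n) // E ∈ π₀.parts}) =
        {⟨Finset.univ, by simp [hπ₀]⟩} := by
      ext ⟨E, hE⟩
      simpa [hπ₀] using hE
    simp only [hg]
    rw [hu, Finset.prod_singleton]
    have hgen : ∀ (m : ℕ) (hm : (Finset.univ : Finset (Fin n)).card = m) (hmn : m = n),
        correlation ρ m (fun j => z ((Finset.univ : Finset (Fin n)).orderEmbOfFin hm j)) =
          correlation ρ n z := by
      intro m hm hmn
      subst hmn
      congr 1
      funext j
      congr 1
      have : (fun j => j : Fin m → Fin m) = (Finset.univ : Finset (Fin m)).orderEmbOfFin hm :=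
        Finset.orderEmbOfFin_unique hm (fun _ => Finset.mem_univ _) strictMono_id
      exact (congrFun this j).symm
    exact hgen _ rfl (by simp)
  have hsplit : ∑ π, g π =
      ∑ π : {π : Finpartition (Finset.univ : Finset (Fin n)) // 1 < π.parts.card}, g π.1 +
        g π₀ := by
    rw [← Finset.sum_filter_add_sum_filter_not Finset.univ
      (fun π : Finpartition (Finset.univ : Finset (Fin n)) => 1 < π.parts.card) g]
    congr 1
    · exact (Finset.sum_subtype _ (by simp) g)
    · simp only [hone, Finset.filter_eq', Finset.mem_univ, if_true, Finset.sum_singleton]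
  rw [hsplit, htop, correlation, if_neg (by omega)]
  simp [hg]

end Correlation

/-! ### Factorial moments, intensity functions, Palm distributions -/

section Moments

variable {Y : Type*} [PseudoMetricSpace Y] [MeasurableSpace Y]

/-- The `n`-th order factorial moment measure `α⁽ⁿ⁾` of the point process `X`, evaluated at `B`. -/
def factorialMoment {Ω : Type*} [MeasurableSpace Ω] (P : Measure Ω) (X : Ω → Config Y) (n : ℕ)
    (B : Set (Fin n → Y)) : ℝ≥0∞ :=
  ∫⁻ ω, distinctSum (X ω) n (B.indicator 1) ∂P

/-- `f` is an `n`-th order intensity function of `X` with respect to the reference measure `R`: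
a density of `α⁽ⁿ⁾` with respect to the `n`-fold product of `R`. -/
def IsIntensityFunction {Ω : Type*} [MeasurableSpace Ω] (P : Measure Ω) (X : Ω → Config Y)
    (R : Measure Y) (n : ℕ) (f : (Fin n → Y) → ℝ≥0) : Prop :=
  Measurable f ∧ ∀ B : Set (Fin n → Y), MeasurableSet B →
    factorialMoment P X n B = ∫⁻ z in B, (f z : ℝ≥0∞) ∂(Measure.pi fun _ : Fin n => R)

/-- `Q` is (a version of) the family of reduced Palm distributions of `X`: a disintegration of the
reduced Campbell measure `C^!(A × N) = 𝔼 ∑_{p ∈ X} 1{p ∈ A, X ∖ p ∈ N}` with respect to the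
intensity measure, which has density `ρ` with respect to `R`. -/
def IsReducedPalm {Ω : Type*} [MeasurableSpace Ω] (P : Measure Ω) (X : Ω → Config Y)
    (R : Measure Y) (ρ : (n : ℕ) → (Fin n → Y) → ℝ≥0) (Q : Kernel Y (Config Y)) : Prop :=
  IsMarkovKernel Q ∧ ∀ (A : Set Y) (N : Set (Config Y)), MeasurableSet A → MeasurableSet N →
    ∫⁻ ω, ∑' p : (X ω).pts,
        {q : Y | q ∈ A ∧ (X ω).erase q ∈ N}.indicator (1 : Y → ℝ≥0∞) p ∂P =
      ∫⁻ p in A, Q p N ∂(R.withDensity fun p => (rho ρ p : ℝ≥0∞))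

end Moments

/-! ### Marked point processes on the sphere and their inhomogeneous summary statistics -/

section Marked

variable {M : Type*} [MetricSpace M] [MeasurableSpace M]

/-- `ρ̄_E`, the infimum of the intensity function over locations in the sphere and marks in `E`. -/
def rhoBar (ρ : (n : ℕ) → (Fin n → S2 × M) → ℝ≥0) (E : Set M) : ℝ :=
  ⨅ p : {p : S2 × M // p.2 ∈ E}, (rho ρ p.1 : ℝ)

/-- Intensity-reweighted momented isotropy of the marked point process `X`, with intensity
functions `ρ⁽ⁿ⁾` with respect to (surface measure) `⊗ ν`. -/
structure IsIRWMI {Ω : Type*} [MeasurableSpace Ω] (P : Measure Ω) (X : Ω → Config (S2 × M))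
    (ν : Measure M) (ρ : (n : ℕ) → (Fin n → S2 × M) → ℝ≥0) : Prop where
  intensity : ∀ n, 1 ≤ n → IsIntensityFunction P X (surf.prod ν) n (ρ n)
  rhoBar_pos : 0 < rhoBar ρ Set.univ
  isotropic : ∀ n, 1 ≤ n → ∀ (z : Fin n → S2 × M) (O : Rot),
    correlation ρ n (fun i => (rotate O (z i).1, (z i).2)) = correlation ρ n z

/-- `u^r_{y,E}(x, m) = ρ̄_E 1{(x, m) ∈ B(y, r) × E} / ρ(x, m)`. -/
def uFun (ρ : (n : ℕ) → (Fin n → S2 × M) → ℝ≥0) (E : Set M) (y : S2) (r : ℝ) (p : S2 × M) : ℝ :=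
  (geoBall y r ×ˢ E).indicator (fun q => rhoBar ρ E / (rho ρ q : ℝ)) p

/-- `F^E_inhom(r)` with reference point `y`: `1 - 𝔼 ∏_{p ∈ X} (1 - u^r_{y,E}(p))`. -/
def FInhom {Ω : Type*} [MeasurableSpace Ω] (P : Measure Ω) (X : Ω → Config (S2 × M))
    (ρ : (n : ℕ) → (Fin n → S2 × M) → ℝ≥0) (E : Set M) (y : S2) (r : ℝ) : ℝ :=
  1 - ∫ ω, pointProd (X ω) (fun p => 1 - uFun ρ E y r p) ∂P

/-- `D^{CE}_inhom(r)` with reference point `y`: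
`1 - ν(C)⁻¹ ∫_C 𝔼^!_{(y,a)} [∏_{p ∈ X} (1 - u^r_{y,E}(p))] ν(da)`. -/
def DInhom (ν : Measure M) (Q : Kernel (S2 × M) (Config (S2 × M)))
    (ρ : (n : ℕ) → (Fin n → S2 × M) → ℝ≥0) (C E : Set M) (y : S2) (r : ℝ) : ℝ :=
  1 - (ν.real C)⁻¹ *
    ∫ a in C, (∫ x, pointProd x (fun p => 1 - uFun ρ E y r p) ∂(Q (y, a))) ∂ν

/-- The measure over which `J_n` is an integral:
`ν` on `C` times the `n`-fold product of (surface measure) `⊗ ν` on `B(o, r) × E`. -/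
def jMeasure (ν : Measure M) (C E : Set M) (r : ℝ) (n : ℕ) : Measure (M × (Fin n → S2 × M)) :=
  (ν.restrict C).prod
    (Measure.pi fun _ : Fin n => (surf.prod ν).restrict (geoBall northPole r ×ˢ E))

/-- The integrand `ξ_{n+1}((y, a), (O_y x₁, m₁), …, (O_y xₙ, mₙ))` of `J_n`. -/
def jIntegrand (ρ : (n : ℕ) → (Fin n → S2 × M) → ℝ≥0) (O : S2 → Rot) (y : S2) (n : ℕ)
    (q : M × (Fin n → S2 × M)) : ℝ :=
  correlation ρ (n + 1)
    (Fin.cons (y, q.1) fun i => (rotate (O y) (q.2 i).1, (q.2 i).2))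

/-- `J^{CE}_n(r)` with reference point `y`. -/
def Jn (ν : Measure M) (ρ : (n : ℕ) → (Fin n → S2 × M) → ℝ≥0) (O : S2 → Rot) (C E : Set M)
    (y : S2) (r : ℝ) (n : ℕ) : ℝ :=
  ∫ q, jIntegrand ρ O y n q ∂(jMeasure ν C E r n)

/-- The partial sum `∑_{n=1}^{k} (-ρ̄_E)ⁿ / n! · J^{CE}_n(r)`. -/
def jPartialSum (ν : Measure M) (ρ : (n : ℕ) → (Fin n → S2 × M) → ℝ≥0) (O : S2 → Rot)
    (C E : Set M) (y : S2) (r : ℝ) (k : ℕ) : ℝ :=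
  ∑ n ∈ Finset.Icc 1 k, (-rhoBar ρ E) ^ n / (n.factorial : ℝ) * Jn ν ρ O C E y r n

/-- The series that defines `J^{CE}_inhom(r)` makes sense: the integrals `J_n` exist, and the
series converges. -/
def JDefined (ν : Measure M) (ρ : (n : ℕ) → (Fin n → S2 × M) → ℝ≥0) (O : S2 → Rot)
    (C E : Set M) (y : S2) (r : ℝ) : Prop :=
  (∀ n, 1 ≤ n → Integrable (jIntegrand ρ O y n) (jMeasure ν C E r n)) ∧
    ∃ l : ℝ, Tendsto (jPartialSum ν ρ O C E y r) atTop (𝓝 l)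

/-- `J^{CE}_inhom(r) = ν(C)⁻¹ (ν(C) + ∑_{n ≥ 1} (-ρ̄_E)ⁿ / n! · J^{CE}_n(r))` with reference
point `y`. -/
def JInhom (ν : Measure M) (ρ : (n : ℕ) → (Fin n → S2 × M) → ℝ≥0) (O : S2 → Rot) (C E : Set M)
    (y : S2) (r : ℝ) : ℝ :=
  (ν.real C)⁻¹ * (ν.real C + limUnder atTop (jPartialSum ν ρ O C E y r))

/-- `∫_{(B(o, r) × E)ⁿ} ρ⁽ⁿ⁾(z₁, …, zₙ) / (ρ(z₁) ⋯ ρ(zₙ)) dz₁ ⋯ dzₙ`. -/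
def reweightedMoment (ν : Measure M) (ρ : (n : ℕ) → (Fin n → S2 × M) → ℝ≥0) (E : Set M)
    (r : ℝ) (n : ℕ) : ℝ≥0∞ :=
  ∫⁻ z, ENNReal.ofReal (rhoRatio ρ n z)
    ∂(Measure.pi fun _ : Fin n => (surf.prod ν).restrict (geoBall northPole r ×ˢ E))

/-- The root-test condition: the limsup of
`(ρ̄_Eⁿ / n! · ∫_{(B(o, r) × E)ⁿ} ρ⁽ⁿ⁾ / (ρ ⋯ ρ))^{1/n}` is smaller than `1`. -/
def RootCondition (ν : Measure M) (ρ : (n : ℕ) → (Fin n → S2 × M) → ℝ≥0) (E : Set M)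
    (r : ℝ) : Prop :=
  limsup (fun n : ℕ =>
    (ENNReal.ofReal (rhoBar ρ E ^ n / (n.factorial : ℝ)) * reweightedMoment ν ρ E r n) ^
      (1 / (n : ℝ))) atTop < 1

/-- `∫_C ∫_{(B(o, r) × E)ⁿ} ρ⁽ⁿ⁺¹⁾((o, a), z₁, …, zₙ) / (ρ(o, a) ρ(z₁) ⋯ ρ(zₙ)) dz₁ ⋯ dzₙ ν(da)`. -/
def crossMoment (ν : Measure M) (ρ : (n : ℕ) → (Fin n → S2 × M) → ℝ≥0) (C E : Set M)
    (r : ℝ) (n : ℕ) : ℝ≥0∞ :=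
  ∫⁻ q, ENNReal.ofReal (rhoRatio ρ (n + 1) (Fin.cons (northPole, q.1) q.2))
    ∂(jMeasure ν C E r n)

/-- Absolute convergence of the series
`∑_{n ≥ 1} (-ρ̄_E)ⁿ / n! ∫_C ∫_{(B(o, r) × E)ⁿ} ρ⁽ⁿ⁺¹⁾ / (ρ ⋯ ρ)`. -/
def CrossSeriesFinite (ν : Measure M) (ρ : (n : ℕ) → (Fin n → S2 × M) → ℝ≥0) (C E : Set M)
    (r : ℝ) : Prop :=
  ∑' n : ℕ, ENNReal.ofReal (rhoBar ρ E ^ (n + 1) / ((n + 1).factorial : ℝ)) *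
    crossMoment ν ρ C E r (n + 1) < ∞

end Marked

end

end SphericalPP

open SphericalPP

/-! The proof compares power series in an auxiliary variable `s` and lets `s` increase to `1`. For
`0 ≤ u ≤ 1` the product `∏ (1 - s u(p))` expands into elementary symmetric sums of the values
`u(p)`, and the expectation of the `n`-th sum is `1/n!` times the integral of `u(z₁) ⋯ u(zₙ)`
against the `n`-th factorial moment measure. With `u = uFun ρ E y r` this is `ρ̄_Eⁿ/n!` times the
integral of `ρ⁽ⁿ⁾/(ρ ⋯ ρ)` over the window around `y`. That ratio is a sum of products of
correlation functions, hence rotation invariant, so the window may be moved to the north pole and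
`y` disappears (`IsIRWMI.expectedEsymm_uFun`). Thus `1 - F` is the Abel sum of an alternating series
whose absolute convergence follows from (R).

The same expansion is used for `D`, with `P` replaced by the finite measure `ν(da) P^!_{(y,a)}(dx)`
on marks in `C` and configurations. Reduced Palm distributions are determined only almost
everywhere. `ae_lintegral_reducedPalm_distinctSum` gives, off one null set and for all test
functions at once, the density `ρ⁽ⁿ⁺¹⁾(p, ·)/ρ(p)` of their factorial moments; this is why part 3
holds for almost every `y` simultaneously in `r`.

The link with `J` is combinatorial. Grouping the partitions of `n + 1` indices by the block that
contains the Palm point gives `rhoRatio_cons_eq_sum`, and integration gives `crossMoment_n = ∑ₖ (n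
choose k) J_k G_{n-k}` with `G` the reweighted moments (`IsIRWMI.crossMoment_eq`). So the series for
`1 - D` is, up to the factor `ν(C)`, the Cauchy product of those for `J` and `1 - F`. The `J` series
need only converge conditionally, so the product is formed for `s < 1`, where everything converges
absolutely, and Abel's theorem yields the limit (`IsIRWMI.crossSeries_eq_mul`). -/

namespace SphericalPP

/-! ### Measurability of sums over the points of a configuration -/

section ConfigMeasurability

variable {Y : Type*} [MetricSpace Y] [MeasurableSpace Y]

/-- The counting measure of a configuration. -/
noncomputable def Config.count (x : Config Y) : Measure Y :=
  Measure.sum fun p : x.pts => Measure.dirac (p : Y)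

theorem Config.lintegral_count (x : Config Y) {f : Y → ℝ≥0∞} (hf : Measurable f) :
    ∫⁻ p, f p ∂x.count = ∑' p : x.pts, f p := by
  simp [Config.count, lintegral_sum_measure, lintegral_dirac' _ hf]

theorem Config.count_apply (x : Config Y) {A : Set Y} (hA : MeasurableSet A) :
    x.count A = ∑' p : x.pts, A.indicator (1 : Y → ℝ≥0∞) p := by
  simp [Config.count, Measure.sum_apply _ hA, Measure.dirac_apply' _ hA]

theorem Config.count_eq_ncard (x : Config Y) {A : Set Y} (hA : MeasurableSet A)
    (hb : Bornology.IsBounded A) : x.count A = ((x.pts ∩ A).ncard : ℝ≥0∞) := by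
  have hfin : (x.pts ∩ A).Finite := x.2 A hA hb
  rw [Config.count_apply x hA, tsum_subtype x.pts (A.indicator (1 : Y → ℝ≥0∞)),
    Set.indicator_indicator, ← tsum_subtype (x.pts ∩ A) (1 : Y → ℝ≥0∞)]
  simp only [Pi.one_apply, ENNReal.tsum_one]
  have : ENat.card ↥(x.pts ∩ A) = ((x.pts ∩ A).ncard : ℕ∞) := by
    rw [hfin.cast_ncard_eq]; rfl
  rw [this]
  simp

theorem measurable_count_of_isBounded {A : Set Y} (hA : MeasurableSet A)
    (hb : Bornology.IsBounded A) : Measurable fun x : Config Y => x.count A := by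
  simp_rw [fun x : Config Y => Config.count_eq_ncard x hA hb]
  have : Measurable fun x : Config Y => (x.pts ∩ A).ncard :=
    measurable_to_countable' fun n =>
      MeasurableSpace.measurableSet_generateFrom ⟨A, n, hA, hb, rfl⟩
  exact (measurable_of_countable fun n : ℕ => (n : ℝ≥0∞)).comp this

theorem Config.count_lt_top (x : Config Y) {A : Set Y} (hA : MeasurableSet A)
    (hb : Bornology.IsBounded A) : x.count A < ∞ := by
  rw [Config.count_eq_ncard x hA hb]
  exact ENNReal.natCast_lt_top _

omit [MeasurableSpace Y] in
theorem iUnion_ball_nat (o : Y) : ⋃ k : ℕ, Metric.ball o k = Set.univ :=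
  Set.eq_univ_of_forall fun y => Set.mem_iUnion.2 (exists_nat_gt (dist y o))

omit [MeasurableSpace Y] in
theorem monotone_ball_nat (o : Y) : Monotone fun k : ℕ => Metric.ball o (k : ℝ) :=
  fun _ _ h => Metric.ball_subset_ball (Nat.cast_le.2 h)

variable {α : Type*} [MeasurableSpace α]

/-- The sum is an integral against the counting measure, which is finite only on bounded sets.
Restricted to a ball it is a kernel with finite values but no uniform bound on the mass, so the
integral is handled by induction on the integrand; monotone convergence along balls of integer
radius then removes the restriction. -/
theorem measurable_tsum_pts [OpensMeasurableSpace Y] {X : α → Config Y} (hX : Measurable X) {f : α → Y → ℝ≥0∞}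
    (hf : Measurable (Function.uncurry f)) :
    Measurable fun a => ∑' p : (X a).pts, f a p := by
  rcases isEmpty_or_nonempty Y with hY | ⟨⟨o⟩⟩
  · have : ∀ a, ∑' p : (X a).pts, f a p = 0 := fun a => by
      have : IsEmpty (X a).pts := ⟨fun p => hY.elim p⟩
      exact tsum_empty
    simp_rw [this]
    exact measurable_const
  have key : Measurable fun a => ∫⁻ p, f a p ∂(X a).count := by
    have hres : ∀ k : ℕ, Measurable fun a =>
        ∫⁻ p in Metric.ball o (k : ℝ), f a p ∂(X a).count := by
      intro k
      let κ : Kernel α Y := ⟨fun a => (X a).count.restrict (Metric.ball o (k : ℝ)), by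
        refine Measure.measurable_of_measurable_coe _ fun A hA => ?_
        simp_rw [Measure.restrict_apply hA]
        exact (measurable_count_of_isBounded (hA.inter measurableSet_ball)
          (Metric.isBounded_ball.subset Set.inter_subset_right)).comp hX⟩
      have hfin : ∀ a, IsFiniteMeasure (κ a) := fun a => ⟨by
        change (X a).count.restrict (Metric.ball o (k : ℝ)) Set.univ < ∞
        rw [Measure.restrict_apply_univ]
        exact Config.count_lt_top _ measurableSet_ball Metric.isBounded_ball⟩
      have hgen : ∀ g : α × Y → ℝ≥0∞, Measurable g →
          Measurable fun a => ∫⁻ p, g (a, p) ∂κ a := by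
        intro g hg
        refine Measurable.ennreal_induction (motive := fun g =>
          Measurable fun a => ∫⁻ p, g (a, p) ∂κ a) ?_ ?_ ?_ hg
        · intro c s hs
          have : ∀ a, ∫⁻ p, s.indicator (fun _ => c) (a, p) ∂κ a =
              c * κ a (Prod.mk a ⁻¹' s) := fun a => by
            rw [← lintegral_indicator_const (measurable_prodMk_left hs)]
            rfl
          simp_rw [this]
          exact (Kernel.measurable_kernel_prodMk_left_of_finite hs hfin).const_mul c
        · intro g₁ g₂ _ h₁ h₂ ih₁ ih₂
          have : ∀ a, ∫⁻ p, (g₁ + g₂) (a, p) ∂κ a =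
              ∫⁻ p, g₁ (a, p) ∂κ a + ∫⁻ p, g₂ (a, p) ∂κ a := fun a =>
            lintegral_add_left (h₁.comp measurable_prodMk_left) _
          simp_rw [this]
          exact ih₁.add ih₂
        · intro g hg hmono ih
          have : ∀ a, ∫⁻ p, ⨆ n, g n (a, p) ∂κ a = ⨆ n, ∫⁻ p, g n (a, p) ∂κ a := fun a =>
            lintegral_iSup (fun n => (hg n).comp measurable_prodMk_left)
              fun i j h p => hmono h (a, p)
          simp_rw [this]
          exact Measurable.iSup ih
      exact hgen _ hf
    have hsup : ∀ a, ∫⁻ p, f a p ∂(X a).count =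
        ⨆ k : ℕ, ∫⁻ p in Metric.ball o (k : ℝ), f a p ∂(X a).count := fun a => by
      rw [← setLIntegral_univ, ← iUnion_ball_nat o]
      exact setLIntegral_iUnion_of_directed _ (monotone_ball_nat o).directed_le
    simp_rw [hsup]
    exact Measurable.iSup hres
  simpa only [fun a => Config.lintegral_count (X a) (f := f a)
    (hf.comp measurable_prodMk_left)] using key

theorem measurable_config_of_count {X : α → Config Y}
    (h : ∀ A : Set Y, MeasurableSet A → Bornology.IsBounded A →
      Measurable fun a => (X a).count A) : Measurable X := by
  refine measurable_generateFrom ?_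
  rintro S ⟨A, n, hA, hb, rfl⟩
  have : X ⁻¹' {x : Config Y | (x.pts ∩ A).ncard = n} = (fun a => (X a).count A) ⁻¹' {(n : ℝ≥0∞)} := by
    ext a
    simp [Config.count_eq_ncard _ hA hb]
  rw [this]
  exact h A hA hb (measurableSet_singleton _)

-- Moves the erased point from the index set to the summand, so that joint measurability in the
-- configuration and the point can be applied.
open Classical in
theorem tsum_erase (x : Config Y) (p : Y) (f : Y → ℝ≥0∞) :
    ∑' q : (x.erase p).pts, f q = ∑' q : x.pts, if (q : Y) = p then 0 else f q := by
  rw [tsum_subtype (x.erase p).pts f, tsum_subtype x.pts fun q => if q = p then 0 else f q]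
  refine tsum_congr fun q => ?_
  by_cases hx : q ∈ x.pts <;> by_cases hq : q = p <;>
    simp [Config.erase, Config.pts, Set.indicator, hq]

theorem Config.measurable_erase [OpensMeasurableSpace Y] [SecondCountableTopology Y] {X : α → Config Y}
    (hX : Measurable X) {p : α → Y} (hp : Measurable p) :
    Measurable fun a => (X a).erase (p a) := by
  classical
  refine measurable_config_of_count fun A hA _ => ?_
  simp_rw [fun a => Config.count_apply ((X a).erase (p a)) hA, tsum_erase]
  refine measurable_tsum_pts hX (f := fun a q => if q = p a then 0 else A.indicator 1 q) ?_
  refine Measurable.ite (measurableSet_eq_fun measurable_snd (hp.comp measurable_fst))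
    measurable_const ?_
  exact (measurable_one.indicator hA).comp measurable_snd

end ConfigMeasurability

/-! ### Sums over tuples of distinct points -/

section DistinctSum

universe u

variable {Y : Type u} [MetricSpace Y] [MeasurableSpace Y]

theorem distinctSum_zero (x : Config Y) (f : (Fin 0 → Y) → ℝ≥0∞) :
    distinctSum x 0 f = f Fin.elim0 := by
  unfold distinctSum
  rw [tsum_eq_single ⟨Fin.elim0, fun i => i.elim0, fun i => i.elim0⟩]
  rintro ⟨z, hz⟩ h
  exact absurd (Subtype.ext (Subsingleton.elim _ _)) h

/-- An injective tuple of `n + 1` points is a point followed by an injective tuple of other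
points. -/
def distinctConsEquiv (x : Config Y) (n : ℕ) :
    (Σ p : x.pts, {z : Fin n → Y // Function.Injective z ∧ ∀ i, z i ∈ (x.erase p).pts}) ≃
      {z : Fin (n + 1) → Y // Function.Injective z ∧ ∀ i, z i ∈ x.pts} where
  toFun q := ⟨Fin.cons q.1 q.2.1, by
    refine ⟨Fin.cons_injective_iff.2 ⟨?_, q.2.2.1⟩, Fin.cases q.1.2 fun i => (q.2.2.2 i).1⟩
    rintro ⟨i, hi⟩
    exact (q.2.2.2 i).2 hi⟩
  invFun z := ⟨⟨z.1 0, z.2.2 0⟩, ⟨Fin.tail z.1, z.2.1.comp (Fin.succ_injective n), fun i =>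
    ⟨z.2.2 i.succ, fun h => Fin.succ_ne_zero i (z.2.1 h)⟩⟩⟩
  left_inv _ := rfl
  right_inv z := by simp

theorem distinctSum_succ (x : Config Y) (n : ℕ) (f : (Fin (n + 1) → Y) → ℝ≥0∞) :
    distinctSum x (n + 1) f =
      ∑' p : x.pts, distinctSum (x.erase p) n fun z => f (Fin.cons (p : Y) z) := by
  unfold distinctSum
  rw [← ENNReal.tsum_sigma, ← (distinctConsEquiv x n).tsum_eq]
  rfl

/-- Peeling off the first point turns it into a parameter, so the induction runs over all parameter
spaces at once and applies its hypothesis to `α × Y`. This is why `α` lives in the universe of `Y`.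
-/
theorem measurable_distinctSum [OpensMeasurableSpace Y] [SecondCountableTopology Y] {n : ℕ} :
    ∀ {α : Type u} [MeasurableSpace α] {X : α → Config Y} (_ : Measurable X)
      {f : α → (Fin n → Y) → ℝ≥0∞} (_ : Measurable (Function.uncurry f)),
      Measurable fun a => distinctSum (X a) n (f a) := by
  induction n with
  | zero =>
    intro α _ X _ f hf
    simp_rw [distinctSum_zero]
    exact hf.comp (measurable_id.prodMk measurable_const)
  | succ n ih =>
    intro α _ X hX f hf
    simp_rw [distinctSum_succ]
    refine measurable_tsum_pts hX (f := fun a p =>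
      distinctSum ((X a).erase p) n fun z => f a (Fin.cons p z)) ?_
    refine ih (α := α × Y) (X := fun q => (X q.1).erase q.2)
      (f := fun q z => f q.1 (Fin.cons q.2 z))
      (Config.measurable_erase (hX.comp measurable_fst) measurable_snd) ?_
    refine hf.comp ((measurable_fst.comp measurable_fst).prodMk ?_)
    refine measurable_pi_iff.2 (Fin.cases ?_ fun i => ?_)
    · exact measurable_snd.comp measurable_fst
    · exact (measurable_pi_apply i).comp measurable_snd

end DistinctSum

/-! ### Campbell formulas -/

section Campbell

universe u

variable {Y : Type u} [MetricSpace Y] [SecondCountableTopology Y] [MeasurableSpace Y]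
  [OpensMeasurableSpace Y]

/-- The counting measure on injective tuples of points of a configuration. -/
noncomputable def Config.tupleCount (n : ℕ) (x : Config Y) : Measure (Fin n → Y) :=
  Measure.sum fun z : {z : Fin n → Y // Function.Injective z ∧ ∀ i, z i ∈ x.pts} =>
    Measure.dirac z.1

omit [SecondCountableTopology Y] [OpensMeasurableSpace Y] in
theorem Config.lintegral_tupleCount {n : ℕ} (x : Config Y) {f : (Fin n → Y) → ℝ≥0∞}
    (hf : Measurable f) : ∫⁻ z, f z ∂x.tupleCount n = distinctSum x n f := by
  simp [Config.tupleCount, distinctSum, lintegral_sum_measure, lintegral_dirac' _ hf]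

omit [SecondCountableTopology Y] [OpensMeasurableSpace Y] in
theorem Config.tupleCount_apply {n : ℕ} (x : Config Y) {B : Set (Fin n → Y)}
    (hB : MeasurableSet B) : x.tupleCount n B = distinctSum x n (B.indicator 1) := by
  rw [← Config.lintegral_tupleCount x (measurable_one.indicator hB), lintegral_indicator_one hB]

theorem Config.measurable_tupleCount (n : ℕ) :
    Measurable (Config.tupleCount n : Config Y → Measure (Fin n → Y)) := by
  refine Measure.measurable_of_measurable_coe _ fun B hB => ?_
  simp_rw [Config.tupleCount_apply _ hB]
  exact measurable_distinctSum measurable_id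
    (f := fun _ => B.indicator 1) ((measurable_one.indicator hB).comp measurable_snd)

variable {Ω : Type*} [MeasurableSpace Ω] {P : Measure Ω} {X : Ω → Config Y} {μ : Measure Y}

/-- Campbell's formula. The intensity function is defined through sets `B`, which says that the
mixture of the tuple counting measures over `P` equals the measure with density `f`; integrals of
arbitrary `g` then agree. -/
theorem lintegral_distinctSum (hX : Measurable X) {n : ℕ} {f : (Fin n → Y) → ℝ≥0}
    (hf : IsIntensityFunction P X μ n f) {g : (Fin n → Y) → ℝ≥0∞} (hg : Measurable g) :
    ∫⁻ ω, distinctSum (X ω) n g ∂P = ∫⁻ z, g z * f z ∂(Measure.pi fun _ => μ) := by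
  have hT : Measurable fun ω => (X ω).tupleCount n := (Config.measurable_tupleCount n).comp hX
  have heq : P.bind (fun ω => (X ω).tupleCount n) =
      (Measure.pi fun _ => μ).withDensity fun z => (f z : ℝ≥0∞) := by
    ext B hB
    rw [Measure.bind_apply hB hT.aemeasurable, withDensity_apply _ hB, ← hf.2 B hB]
    simp_rw [Config.tupleCount_apply _ hB]
    rfl
  have h := Measure.lintegral_bind (m := P) (f := g) hT.aemeasurable hg.aemeasurable
  rw [heq, lintegral_withDensity_eq_lintegral_mul _ hf.1.coe_nnreal_ennreal hg] at h
  simp_rw [Config.lintegral_tupleCount _ hg] at h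
  rw [← h]
  exact lintegral_congr fun z => mul_comm _ _

/-- The definition of `Q` identifies the reduced Campbell measure with `τ ⊗ₘ Q` on rectangles. These
form a generating `π`-system, and spanning sets of `τ` times the whole configuration space have
finite mass because `Q` is Markov, so the two measures coincide. -/
theorem lintegral_reducedPalm [SigmaFinite μ] (hX : Measurable X)
    {ρ : (n : ℕ) → (Fin n → Y) → ℝ≥0} (hρ : Measurable (rho ρ)) {Q : Kernel Y (Config Y)}
    (hQ : IsReducedPalm P X μ ρ Q) {g : Y → Config Y → ℝ≥0∞}
    (hg : Measurable (Function.uncurry g)) :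
    ∫⁻ ω, ∑' p : (X ω).pts, g p ((X ω).erase p) ∂P =
      ∫⁻ p, (∫⁻ x, g p x ∂Q p) * rho ρ p ∂μ := by
  have := hQ.1
  set κ : Ω → Measure (Y × Config Y) := fun ω =>
    Measure.sum fun p : (X ω).pts => Measure.dirac ((p : Y), (X ω).erase p) with hκ
  have hκl : ∀ (h : Y × Config Y → ℝ≥0∞), Measurable h → ∀ ω,
      ∫⁻ q, h q ∂κ ω = ∑' p : (X ω).pts, h (p, (X ω).erase p) := fun h hh ω => by
    simp [hκ, lintegral_sum_measure, lintegral_dirac' _ hh]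
  have hmeas : ∀ (h : Y × Config Y → ℝ≥0∞), Measurable h →
      Measurable fun ω => ∑' p : (X ω).pts, h (p, (X ω).erase p) := fun h hh =>
    measurable_tsum_pts hX (f := fun ω p => h (p, (X ω).erase p))
      (hh.comp (measurable_snd.prodMk
        (Config.measurable_erase (hX.comp measurable_fst) measurable_snd)))
  have hκa : ∀ S, MeasurableSet S → ∀ ω,
      κ ω S = ∑' p : (X ω).pts, S.indicator 1 ((p : Y), (X ω).erase p) := fun S hS ω => by
    rw [← lintegral_indicator_one hS, hκl _ (measurable_one.indicator hS)]
  have hκm : Measurable κ := by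
    refine Measure.measurable_of_measurable_coe _ fun S hS => ?_
    simp_rw [hκa S hS]
    exact hmeas _ (measurable_one.indicator hS)
  set τ : Measure Y := μ.withDensity fun p => (rho ρ p : ℝ≥0∞) with hτ
  have : SigmaFinite τ := inferInstanceAs (SigmaFinite (μ.withDensity fun p => (rho ρ p : ℝ≥0∞)))
  have hrect : ∀ (A : Set Y) (N : Set (Config Y)), MeasurableSet A → MeasurableSet N →
      (P.bind κ) (A ×ˢ N) = (τ ⊗ₘ Q) (A ×ˢ N) := by
    intro A N hA hN
    rw [Measure.bind_apply (hA.prod hN) hκm.aemeasurable, Measure.compProd_apply_prod hA hN,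
      ← hQ.2 A N hA hN]
    simp_rw [hκa _ (hA.prod hN)]
    rfl
  have heq : τ ⊗ₘ Q = P.bind κ := by
    refine Measure.ext_of_generateFrom_of_iUnion
      (Set.image2 (· ×ˢ ·) {s : Set Y | MeasurableSet s} {t : Set (Config Y) | MeasurableSet t})
      (fun i => spanningSets τ i ×ˢ Set.univ) generateFrom_prod.symm isPiSystem_prod ?_ ?_ ?_ ?_
    · rw [← Set.iUnion_prod_const, iUnion_spanningSets, Set.univ_prod_univ]
    · exact fun i => ⟨_, measurableSet_spanningSets τ i, Set.univ, MeasurableSet.univ (α := Config Y), rfl⟩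
    · intro i
      rw [Measure.compProd_apply_prod (measurableSet_spanningSets τ i) MeasurableSet.univ]
      simpa using (measure_spanningSets_lt_top τ i).ne
    · rintro _ ⟨A, hA, N, hN, rfl⟩
      exact (hrect A N hA hN).symm
  have h1 := Measure.lintegral_bind (m := P) (f := Function.uncurry g) hκm.aemeasurable
    hg.aemeasurable
  rw [← heq, Measure.lintegral_compProd hg, hτ, lintegral_withDensity_eq_lintegral_mul _
    hρ.coe_nnreal_ennreal hg.lintegral_kernel_prod_right'] at h1
  simp_rw [hκl _ hg] at h1
  refine h1.symm.trans (lintegral_congr fun p => ?_)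
  rw [Pi.mul_apply, mul_comm]
  rfl

/-- Integrals of tuple sums under the reduced Palm distributions. -/
theorem lintegral_reducedPalm_distinctSum [SigmaFinite μ] (hX : Measurable X)
    {ρ : (n : ℕ) → (Fin n → Y) → ℝ≥0} (hρ : Measurable (rho ρ)) {Q : Kernel Y (Config Y)}
    (hQ : IsReducedPalm P X μ ρ Q) {n : ℕ} (hn : IsIntensityFunction P X μ (n + 1) (ρ (n + 1)))
    {f : Y → (Fin n → Y) → ℝ≥0∞} (hf : Measurable (Function.uncurry f)) :
    ∫⁻ p, (∫⁻ x, distinctSum x n (f p) ∂Q p) * rho ρ p ∂μ =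
      ∫⁻ p, ∫⁻ z, f p z * ρ (n + 1) (Fin.cons p z) ∂(Measure.pi fun _ => μ) ∂μ := by
  have hg : Measurable (Function.uncurry fun (p : Y) (x : Config Y) => distinctSum x n (f p)) :=
    measurable_distinctSum (α := Y × Config Y) (X := Prod.snd) (f := fun q => f q.1)
      measurable_snd (hf.comp ((measurable_fst.comp measurable_fst).prodMk measurable_snd))
  rw [← lintegral_reducedPalm hX hρ hQ hg]
  -- A point followed by a tuple of other points is a tuple of length `n + 1`, so Campbell's formula
  -- of order `n + 1` applies.
  have hsucc : ∀ ω, ∑' p : (X ω).pts, distinctSum ((X ω).erase p) n (f p) =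
      distinctSum (X ω) (n + 1) fun z => f (z 0) (Fin.tail z) := fun ω => by
    rw [distinctSum_succ]
    simp
  simp_rw [hsucc]
  have htail : Measurable fun z : Fin (n + 1) → Y => (z 0, Fin.tail z) :=
    (measurable_pi_apply 0).prodMk (measurable_pi_iff.2 fun i => measurable_pi_apply i.succ)
  rw [lintegral_distinctSum hX hn (g := fun z => f (z 0) (Fin.tail z)) (hf.comp htail)]
  have hmp := measurePreserving_piFinSuccAbove (fun _ : Fin (n + 1) => μ) 0
  have hcons : Measurable fun q : Y × (Fin n → Y) => (Fin.cons q.1 q.2 : Fin (n + 1) → Y) :=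
    measurable_pi_iff.2 (Fin.cases measurable_fst fun i => (measurable_pi_apply i).comp measurable_snd)
  rw [← lintegral_prod (fun q : Y × (Fin n → Y) => f q.1 q.2 * ρ (n + 1) (Fin.cons q.1 q.2))
    (hf.mul (hn.1.comp hcons).coe_nnreal_ennreal).aemeasurable, ← hmp.lintegral_comp_emb
      (MeasurableEquiv.measurableEmbedding _)]
  refine lintegral_congr fun z => ?_
  simp only [MeasurableEquiv.piFinSuccAbove_apply,
    Fin.insertNthEquiv_zero]
  congr 3
  exact (Fin.cons_self_tail z).symm

end Campbell

/-! ### Factorial moments of the reduced Palm distributions -/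

section PalmDensity

universe u

/-- A countable `π`-system that generates the σ-algebra. -/
theorem exists_countable_generating_piSystem (Z : Type*) [m : MeasurableSpace Z]
    [MeasurableSpace.CountablyGenerated Z] :
    ∃ B : Finset ℕ → Set Z, (∀ s, MeasurableSet (B s)) ∧ IsPiSystem (Set.range B) ∧
      m = MeasurableSpace.generateFrom (Set.range B) ∧ B ∅ = Set.univ := by
  classical
  -- Finite intersections of a countable generating sequence; the empty intersection supplies the
  -- whole space, needed later to compare total masses.
  refine ⟨fun s => ⋂ i ∈ s, MeasurableSpace.natGeneratingSequence Z i, fun s =>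
    Finset.measurableSet_biInter s fun i _ =>
      MeasurableSpace.measurableSet_natGeneratingSequence i, ?_, ?_, by simp⟩
  · rintro _ ⟨s, rfl⟩ _ ⟨t, rfl⟩ _
    exact ⟨s ∪ t, by simp only [Finset.mem_union, Set.iInter_or, Set.iInter_inter_distrib]⟩
  · refine le_antisymm ?_ (MeasurableSpace.generateFrom_le ?_)
    · conv_lhs => rw [← MeasurableSpace.generateFrom_natGeneratingSequence Z]
      refine MeasurableSpace.generateFrom_mono ?_
      rintro _ ⟨i, rfl⟩
      exact ⟨{i}, by simp⟩
    · rintro _ ⟨s, rfl⟩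
      exact Finset.measurableSet_biInter s fun i _ =>
        MeasurableSpace.measurableSet_natGeneratingSequence i

variable {Y : Type u} [MetricSpace Y] [SecondCountableTopology Y] [MeasurableSpace Y]
  [BorelSpace Y] {Ω : Type*} [MeasurableSpace Ω] {P : Measure Ω} {X : Ω → Config Y}
  {μ : Measure Y}

/-- For almost every `p`, the `n`-th factorial moment measure of the reduced Palm distribution at
`p` has density `ρ⁽ⁿ⁺¹⁾(p, ·) / ρ(p)`. -/
theorem ae_lintegral_reducedPalm_distinctSum [SigmaFinite μ] (hX : Measurable X)
    {ρ : (n : ℕ) → (Fin n → Y) → ℝ≥0} (hρ : Measurable (rho ρ)) (hpos : ∀ p, rho ρ p ≠ 0)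
    {Q : Kernel Y (Config Y)} (hQ : IsReducedPalm P X μ ρ Q) {n : ℕ}
    (hn : IsIntensityFunction P X μ (n + 1) (ρ (n + 1))) :
    ∀ᵐ p ∂μ, ∀ g : (Fin n → Y) → ℝ≥0∞, Measurable g →
      ∫⁻ x, distinctSum x n g ∂Q p =
        ∫⁻ z, g z * (ρ (n + 1) (Fin.cons p z) / rho ρ p : ℝ≥0) ∂(Measure.pi fun _ => μ) := by
  obtain ⟨B, hBm, hBpi, hBgen, hBuniv⟩ := exists_countable_generating_piSystem (Fin n → Y)
  have hcons : Measurable fun q : Y × (Fin n → Y) => (Fin.cons q.1 q.2 : Fin (n + 1) → Y) :=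
    measurable_pi_iff.2 (Fin.cases measurable_fst fun i => (measurable_pi_apply i).comp measurable_snd)
  have hcons' : ∀ p : Y, Measurable fun z : Fin n → Y => (Fin.cons p z : Fin (n + 1) → Y) :=
    fun p => hcons.comp measurable_prodMk_left
  -- Uniqueness of measures needs finite mass. On the sections of `W k` the tuple stays in a box of
  -- finite measure and the density is at most `k`, so `β p` is finite there, and the sections
  -- exhaust the tuple space for every `p`.
  set A : ℕ → Set (Fin n → Y) := fun k => Set.univ.pi fun _ => spanningSets μ k with hA
  have hAm : ∀ k, MeasurableSet (A k) := fun k =>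
    MeasurableSet.univ_pi fun _ => measurableSet_spanningSets μ k
  set W : ℕ → Set (Y × (Fin n → Y)) := fun k =>
    {q | q.2 ∈ A k ∧ ρ (n + 1) (Fin.cons q.1 q.2) ≤ k} with hW
  have hWm : ∀ k, MeasurableSet (W k) := fun k =>
    (measurable_snd (hAm k)).inter (measurableSet_le (f := fun q : Y × (Fin n → Y) => ρ (n + 1) (Fin.cons q.1 q.2))
      (hn.1.comp hcons) measurable_const)
  have hWs : ∀ k p, MeasurableSet (Prod.mk p ⁻¹' W k) := fun k p => measurable_prodMk_left (hWm k)
  have hWu : ∀ p, ⋃ k, Prod.mk p ⁻¹' W k = Set.univ := by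
    refine fun p => Set.eq_univ_of_forall fun z => Set.mem_iUnion.2 ?_
    obtain ⟨k, hk⟩ := exists_nat_ge (ρ (n + 1) (Fin.cons p z))
    have : ∀ i, ∃ k, z i ∈ spanningSets μ k := fun i =>
      Set.mem_iUnion.1 ((iUnion_spanningSets μ).symm ▸ Set.mem_univ (z i))
    choose c hc using this
    refine ⟨max k (Finset.univ.sup c), fun i _ => ?_, hk.trans (Nat.cast_le.2 (le_max_left _ _))⟩
    exact monotone_spanningSets μ ((Finset.le_sup (Finset.mem_univ i)).trans (le_max_right _ _))
      (hc i)
  set α : Y → Measure (Fin n → Y) := fun p => (Q p).bind (Config.tupleCount n) with hα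
  set β : Y → Measure (Fin n → Y) := fun p => (Measure.pi fun _ => μ).withDensity
    fun z => ((ρ (n + 1) (Fin.cons p z) / rho ρ p : ℝ≥0) : ℝ≥0∞) with hβ
  have hαl : ∀ p (g : (Fin n → Y) → ℝ≥0∞), Measurable g →
      ∫⁻ z, g z ∂α p = ∫⁻ x, distinctSum x n g ∂Q p := fun p g hg => by
    simp_rw [hα, Measure.lintegral_bind (Config.measurable_tupleCount n).aemeasurable
      hg.aemeasurable, Config.lintegral_tupleCount _ hg]
  have hβd : ∀ p, Measurable fun z : Fin n → Y =>
      ((ρ (n + 1) (Fin.cons p z) / rho ρ p : ℝ≥0) : ℝ≥0∞) := fun p =>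
    ((hn.1.comp (hcons' p)).div_const _).coe_nnreal_ennreal
  have key : ∀ (k : ℕ) (s : Finset ℕ), ∀ᵐ p ∂μ,
      α p (B s ∩ Prod.mk p ⁻¹' W k) = β p (B s ∩ Prod.mk p ⁻¹' W k) := by
    intro k s
    set T : Set (Y × (Fin n → Y)) := W k ∩ Prod.snd ⁻¹' B s with hT
    have hTm : MeasurableSet T := (hWm k).inter (measurable_snd (hBm s))
    set f : Y → (Fin n → Y) → ℝ≥0∞ := fun p z => T.indicator 1 (p, z) with hf
    have hfm : Measurable (Function.uncurry f) := measurable_one.indicator hTm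
    have hgm : Measurable fun p => ∫⁻ x, distinctSum x n (f p) ∂Q p := by
      have := hQ.1
      have : Measurable (Function.uncurry fun (p : Y) (x : Config Y) => distinctSum x n (f p)) :=
        measurable_distinctSum (α := Y × Config Y) (X := Prod.snd) (f := fun q => f q.1)
          measurable_snd (hfm.comp ((measurable_fst.comp measurable_fst).prodMk measurable_snd))
      exact this.lintegral_kernel_prod_right
    -- Inserting an indicator `1_S(p)` into the integrated formula shows that both functions of `p`
    -- have the same integral over every measurable `S`.
    have hae : (fun p => (∫⁻ x, distinctSum x n (f p) ∂Q p) * rho ρ p) =ᵐ[μ]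
        fun p => ∫⁻ z, f p z * ρ (n + 1) (Fin.cons p z) ∂(Measure.pi fun _ => μ) := by
      have hrm : Measurable fun q : Y × (Fin n → Y) =>
          f q.1 q.2 * (ρ (n + 1) (Fin.cons q.1 q.2) : ℝ≥0∞) :=
        hfm.mul (hn.1.comp hcons).coe_nnreal_ennreal
      refine ae_eq_of_forall_setLIntegral_eq_of_sigmaFinite (hgm.mul hρ.coe_nnreal_ennreal)
        hrm.lintegral_prod_right' fun S hS _ => ?_
      have h := lintegral_reducedPalm_distinctSum hX hρ hQ hn
        (f := fun p z => S.indicator 1 p * f p z)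
        (((measurable_one.indicator hS).comp measurable_fst).mul hfm)
      rw [← lintegral_indicator hS, ← lintegral_indicator hS]
      refine Eq.trans (lintegral_congr fun p => ?_) (h.trans (lintegral_congr fun p => ?_))
      · by_cases hp : p ∈ S <;> simp [hp, distinctSum]
      · by_cases hp : p ∈ S <;> simp [hp]
    filter_upwards [hae] with p hp
    have hBW : MeasurableSet (B s ∩ Prod.mk p ⁻¹' W k) := (hBm s).inter (hWs k p)
    have hfp : f p = (B s ∩ Prod.mk p ⁻¹' W k).indicator 1 := by
      ext z
      simp only [hf]
      by_cases hz : (p, z) ∈ T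
      · rw [Set.indicator_of_mem hz, Set.indicator_of_mem
          (show z ∈ B s ∩ Prod.mk p ⁻¹' W k from ⟨hz.2, hz.1⟩)]
        rfl
      · rw [Set.indicator_of_notMem hz, Set.indicator_of_notMem
          (show z ∉ B s ∩ Prod.mk p ⁻¹' W k from fun h => hz ⟨h.2, h.1⟩)]
    have h0 : (rho ρ p : ℝ≥0∞) ≠ 0 := ENNReal.coe_ne_zero.2 (hpos p)
    rw [← lintegral_indicator_one hBW, ← lintegral_indicator_one hBW,
      hαl _ _ (measurable_one.indicator hBW), hβ,
      lintegral_withDensity_eq_lintegral_mul _ (hβd p) (measurable_one.indicator hBW), ← hfp,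
      ← ENNReal.mul_left_inj h0 ENNReal.coe_ne_top, hp, ← lintegral_mul_const _
        ((hβd p).mul (show Measurable (f p) from hfm.comp measurable_prodMk_left))]
    refine lintegral_congr fun z => ?_
    rw [Pi.mul_apply, mul_right_comm, ← ENNReal.coe_mul, div_mul_cancel₀ _ (hpos p), mul_comm]
  -- There are only countably many pairs `(k, s)`, so one null set serves all of them, and hence
  -- every test function `g`.
  have key' : ∀ᵐ p ∂μ, ∀ (k : ℕ) (s : Finset ℕ),
      α p (B s ∩ Prod.mk p ⁻¹' W k) = β p (B s ∩ Prod.mk p ⁻¹' W k) :=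
    ae_all_iff.2 fun k => ae_all_iff.2 fun s => key k s
  filter_upwards [key'] with p hp g hg
  have hαβ : α p = β p := by
    refine (Measure.ext_iff_of_iUnion_eq_univ (hWu p)).2 fun k => ?_
    have hfin : β p (Prod.mk p ⁻¹' W k) < ∞ := by
      rw [hβ, withDensity_apply _ (hWs k p)]
      have hle : ∀ z ∈ Prod.mk p ⁻¹' W k, ((ρ (n + 1) (Fin.cons p z) / rho ρ p : ℝ≥0) : ℝ≥0∞) ≤
          ((k / rho ρ p : ℝ≥0) : ℝ≥0∞) := fun z hz =>
        ENNReal.coe_le_coe.2 (by gcongr; exact hz.2)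
      refine (setLIntegral_mono measurable_const hle).trans_lt ?_
      rw [setLIntegral_const]
      refine ENNReal.mul_lt_top ENNReal.coe_lt_top ?_
      refine (measure_mono (t := A k) fun z hz => hz.1).trans_lt ?_
      rw [hA, Measure.pi_pi]
      exact ENNReal.prod_lt_top fun i _ => measure_spanningSets_lt_top μ k
    have h1 := hp k
    have : IsFiniteMeasure ((α p).restrict (Prod.mk p ⁻¹' W k)) := ⟨by
      have := h1 ∅
      rw [hBuniv, Set.univ_inter] at this
      rw [Measure.restrict_apply_univ, this]
      exact hfin⟩
    refine ext_of_generate_finite _ hBgen hBpi ?_ ?_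
    · rintro _ ⟨s, rfl⟩
      rw [Measure.restrict_apply (hBm s), Measure.restrict_apply (hBm s), h1 s]
    · have := h1 ∅
      rw [hBuniv] at this
      rw [Measure.restrict_apply MeasurableSet.univ, Measure.restrict_apply MeasurableSet.univ,
        this]
  rw [← hαl p g hg, hαβ, hβ, lintegral_withDensity_eq_lintegral_mul _ (hβd p) hg]
  exact lintegral_congr fun z => mul_comm _ _

end PalmDensity

/-! ### Infinite products with factors in the unit interval -/

section UnitProducts

variable {ι : Type*}

/-- Finite products decrease as factors are added and stay nonnegative. Hence the product always
converges unconditionally and `∏'` never takes its default value. -/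
theorem hasProd_unitInterval {v : ι → ℝ} (h0 : ∀ i, 0 ≤ v i) (h1 : ∀ i, v i ≤ 1) :
    HasProd v (⨅ F : Finset ι, ∏ i ∈ F, v i) := by
  refine tendsto_atTop_ciInf (fun F G h => ?_) ⟨0, ?_⟩
  · classical
    rw [← Finset.prod_sdiff h]
    exact mul_le_of_le_one_left (Finset.prod_nonneg fun i _ => h0 i)
      (Finset.prod_le_one (fun i _ => h0 i) fun i _ => h1 i)
  · rintro _ ⟨F, rfl⟩
    exact Finset.prod_nonneg fun i _ => h0 i

theorem tprod_le_prod_unitInterval {v : ι → ℝ} (h0 : ∀ i, 0 ≤ v i) (h1 : ∀ i, v i ≤ 1)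
    (F : Finset ι) : ∏' i, v i ≤ ∏ i ∈ F, v i := by
  rw [(hasProd_unitInterval h0 h1).tprod_eq]
  exact ciInf_le ⟨0, by rintro _ ⟨F, rfl⟩; exact Finset.prod_nonneg fun i _ => h0 i⟩ F

theorem tprod_mono_unitInterval {v w : ι → ℝ} (h0 : ∀ i, 0 ≤ v i) (h1 : ∀ i, w i ≤ 1)
    (h : ∀ i, v i ≤ w i) : ∏' i, v i ≤ ∏' i, w i := by
  rw [(hasProd_unitInterval (fun i => (h0 i).trans (h i)) h1).tprod_eq]
  exact le_ciInf fun F => (tprod_le_prod_unitInterval h0 (fun i => (h i).trans (h1 i)) F).trans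
    (Finset.prod_le_prod (fun i _ => h0 i) fun i _ => h i)

theorem tprod_nonneg_unitInterval {v : ι → ℝ} (h0 : ∀ i, 0 ≤ v i) (h1 : ∀ i, v i ≤ 1) :
    0 ≤ ∏' i, v i := by
  rw [(hasProd_unitInterval h0 h1).tprod_eq]
  exact le_ciInf fun F => Finset.prod_nonneg fun i _ => h0 i

theorem tprod_le_one_unitInterval {v : ι → ℝ} (h0 : ∀ i, 0 ≤ v i) (h1 : ∀ i, v i ≤ 1) :
    ∏' i, v i ≤ 1 := by
  simpa using tprod_le_prod_unitInterval h0 h1 ∅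

/-- No summability of `f` is required. From below, each product with `s < 1` dominates the limit by
monotonicity; from above, it is bounded by a finite subproduct, which is continuous in `s` and can
be chosen close to the infimum. -/
theorem tendsto_tprod_one_sub_mul {f : ι → ℝ} (h0 : ∀ i, 0 ≤ f i) (h1 : ∀ i, f i ≤ 1) :
    Tendsto (fun s : ℝ => ∏' i, (1 - s * f i)) (𝓝[<] 1) (𝓝 (∏' i, (1 - f i))) := by
  have hs : ∀ᶠ s : ℝ in 𝓝[<] 1, s ∈ Set.Ioo (0 : ℝ) 1 := Ioo_mem_nhdsLT one_pos
  have hv0 : ∀ s ∈ Set.Ioo (0 : ℝ) 1, ∀ i, 0 ≤ 1 - s * f i := fun s hs i =>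
    sub_nonneg.2 (mul_le_one₀ hs.2.le (h0 i) (h1 i))
  have hv1 : ∀ s ∈ Set.Ioo (0 : ℝ) 1, ∀ i, 1 - s * f i ≤ 1 := fun s hs i =>
    sub_le_self _ (mul_nonneg hs.1.le (h0 i))
  have h0' : ∀ i, 0 ≤ 1 - f i := fun i => sub_nonneg.2 (h1 i)
  have h1' : ∀ i, 1 - f i ≤ 1 := fun i => sub_le_self _ (h0 i)
  refine tendsto_order.2 ⟨fun a ha => ?_, fun a ha => ?_⟩
  · filter_upwards [hs] with s hs
    refine ha.trans_le (tprod_mono_unitInterval h0' (hv1 s hs) fun i => ?_)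
    exact sub_le_sub_left (mul_le_of_le_one_left (h0 i) hs.2.le) 1
  · rw [(hasProd_unitInterval h0' h1').tprod_eq] at ha
    obtain ⟨F, hF⟩ := exists_lt_of_ciInf_lt ha
    have hcont : Tendsto (fun s : ℝ => ∏ i ∈ F, (1 - s * f i)) (𝓝[<] 1)
        (𝓝 (∏ i ∈ F, (1 - f i))) := by
      have : Continuous fun s : ℝ => ∏ i ∈ F, (1 - s * f i) := by fun_prop
      simpa using (this.tendsto 1).mono_left nhdsWithin_le_nhds
    filter_upwards [hs, hcont.eventually_lt_const hF] with s hs h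
    exact (tprod_le_prod_unitInterval (hv0 s hs) (hv1 s hs) F).trans_lt h

end UnitProducts

/-! ### Elementary symmetric sums -/

section ElementarySymmetric

variable {ι : Type*}

/-- The sum over all `n`-element subsets of the products of the values. -/
noncomputable def esymmSum (w : ι → ℝ≥0∞) (n : ℕ) : ℝ≥0∞ :=
  ∑' F : {F : Finset ι // F.card = n}, ∏ i ∈ F.1, w i

/-- The injective enumerations of a finite set are the bijections onto it. -/
noncomputable def embeddingFiberEquiv {n : ℕ} (F : Finset ι) :
    {z : Fin n ↪ ι // Finset.univ.map z = F} ≃ (Fin n ≃ F) where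
  toFun z := Equiv.ofBijective
    (fun i => (⟨z.1 i, z.2.subset (Finset.mem_map_of_mem z.1 (Finset.mem_univ i))⟩ : F)) (by
      refine ⟨fun i j h => z.1.injective (Subtype.ext_iff.1 h), fun p => ?_⟩
      obtain ⟨i, -, hi⟩ := Finset.mem_map.1 (z.2.symm.subset p.2)
      exact ⟨i, Subtype.ext hi⟩)
  invFun e := ⟨e.toEmbedding.trans (Function.Embedding.subtype _), by
    ext p
    simp only [Finset.mem_map, Finset.mem_univ, true_and]
    exact ⟨fun ⟨i, hi⟩ => hi ▸ (e i).2, fun hp => ⟨e.symm ⟨p, hp⟩, by simp⟩⟩⟩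
  left_inv z := rfl
  right_inv e := by ext; rfl

/-- Embeddings are grouped by their image: each `n`-element set has `n!` enumerations, and the
product does not depend on the enumeration. -/
theorem tsum_embedding_prod (w : ι → ℝ≥0∞) (n : ℕ) :
    ∑' z : Fin n ↪ ι, ∏ i, w (z i) = n.factorial * esymmSum w n := by
  classical
  have hfib : ∀ F : Finset ι, ∑' z : {z : Fin n ↪ ι // Finset.univ.map z = F}, ∏ i, w (z.1 i) =
      if F.card = n then n.factorial * ∏ i ∈ F, w i else 0 := by
    intro F
    have hval : ∀ z : {z : Fin n ↪ ι // Finset.univ.map z = F},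
        ∏ i, w (z.1 i) = ∏ i ∈ F, w i := fun z => by
      conv_rhs => rw [← z.2]
      rw [Finset.prod_map]
    simp_rw [hval]
    split_ifs with hF
    · have e : Fin n ≃ F := (finCongr hF.symm).trans F.equivFin.symm
      rw [← (embeddingFiberEquiv F).symm.tsum_eq, tsum_fintype, Finset.sum_const,
        Finset.card_univ, Fintype.card_equiv e, Fintype.card_fin, nsmul_eq_mul]
    · have : IsEmpty {z : Fin n ↪ ι // Finset.univ.map z = F} := ⟨fun z => hF (by
        rw [← z.2]; simp)⟩
      exact tsum_empty
  rw [← (Equiv.sigmaFiberEquiv fun z : Fin n ↪ ι => Finset.univ.map z).tsum_eq,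
    ENNReal.tsum_sigma']
  refine (tsum_congr hfib).trans ?_
  rw [esymmSum, ← ENNReal.tsum_mul_left]
  refine Eq.trans (tsum_congr fun F => ?_) (tsum_subtype {F : Finset ι | F.card = n}
    fun F => (n.factorial : ℝ≥0∞) * ∏ i ∈ F, w i).symm
  simp [Set.indicator]

theorem tsum_esymmSum (w : ι → ℝ≥0∞) : ∑' n, esymmSum w n = ∑' F : Finset ι, ∏ i ∈ F, w i := by
  rw [← (Equiv.sigmaFiberEquiv (Finset.card : Finset ι → ℕ)).tsum_eq, ENNReal.tsum_sigma']
  rfl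

theorem esymmSum_const_mul (s : ℝ≥0∞) (w : ι → ℝ≥0∞) (n : ℕ) :
    esymmSum (fun i => s * w i) n = s ^ n * esymmSum w n := by
  rw [esymmSum, esymmSum, ← ENNReal.tsum_mul_left]
  refine tsum_congr fun F => ?_
  rw [Finset.prod_mul_distrib, Finset.prod_const, F.2]

/-- Expansion of `∏ (1 - s f)` in elementary symmetric sums. -/
theorem tprod_one_sub_mul_eq_tsum {f : ι → ℝ} (h0 : ∀ i, 0 ≤ f i) {s : ℝ} (hs : 0 ≤ s)
    (hfin : ∑' n, ENNReal.ofReal (s ^ n) * esymmSum (fun i => ENNReal.ofReal (f i)) n ≠ ∞) :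
    ∏' i, (1 - s * f i) =
      ∑' n, (-s) ^ n * (esymmSum (fun i => ENNReal.ofReal (f i)) n).toReal := by
  have hterm : ∀ F : Finset ι, ENNReal.ofReal (∏ i ∈ F, s * f i) =
      ∏ i ∈ F, ENNReal.ofReal s * ENNReal.ofReal (f i) := fun F => by
    rw [ENNReal.ofReal_prod_of_nonneg fun i _ => mul_nonneg hs (h0 i)]
    exact Finset.prod_congr rfl fun i _ => ENNReal.ofReal_mul hs
  -- Grouped by cardinality, the sum over all finite subsets is the finite series in `hfin`; this is
  -- the absolute convergence needed to expand the infinite product.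
  have hsum : Summable fun F : Finset ι => ∏ i ∈ F, s * f i := by
    have h : ∑' F : Finset ι, ENNReal.ofReal (∏ i ∈ F, s * f i) ≠ ∞ := by
      simp_rw [hterm]
      rw [← tsum_esymmSum]
      simpa only [esymmSum_const_mul, ENNReal.ofReal_pow hs] using hfin
    have := ENNReal.summable_toReal h
    refine this.congr fun F => ?_
    rw [ENNReal.toReal_ofReal (Finset.prod_nonneg fun i _ => mul_nonneg hs (h0 i))]
  have hneg : ∀ F : Finset ι, ∏ i ∈ F, -(s * f i) = (-1) ^ F.card * ∏ i ∈ F, s * f i := fun F => by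
    rw [← Finset.prod_const, ← Finset.prod_mul_distrib]
    simp
  have hsum' : Summable fun F : Finset ι => ∏ i ∈ F, -(s * f i) := by
    refine Summable.of_norm ?_
    refine hsum.congr fun F => ?_
    rw [hneg, norm_mul, norm_pow, norm_neg, norm_one, one_pow, one_mul, Real.norm_of_nonneg]
    exact Finset.prod_nonneg fun i _ => mul_nonneg hs (h0 i)
  simp_rw [sub_eq_add_neg]
  rw [tprod_one_add hsum', ← (Equiv.sigmaFiberEquiv (Finset.card : Finset ι → ℕ)).tsum_eq]
  refine (((Equiv.sigmaFiberEquiv (Finset.card : Finset ι → ℕ)).summable_iff.2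
    hsum').tsum_sigma).trans (tsum_congr fun n => ?_)
  rw [esymmSum, ENNReal.tsum_toReal_eq fun F => ENNReal.prod_ne_top fun i _ =>
    ENNReal.ofReal_ne_top, ← tsum_mul_left]
  refine tsum_congr fun F => ?_
  have hc : F.1.card = n := F.2
  simp only [Function.comp_apply, Equiv.sigmaFiberEquiv, Equiv.coe_fn_mk]
  rw [hneg, Finset.prod_mul_distrib, Finset.prod_const, hc, ENNReal.toReal_prod, ← mul_assoc,
    ← mul_pow, neg_one_mul]
  congr 1
  exact Finset.prod_congr rfl fun i _ => (ENNReal.toReal_ofReal (h0 i)).symm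

end ElementarySymmetric

/-! ### Factorial power sums of a configuration -/

section DistinctSumProd

variable {Y : Type*} [MetricSpace Y] [MeasurableSpace Y]

/-- Injective tuples of points of a configuration as embeddings. -/
def distinctEmbeddingEquiv (x : Config Y) (n : ℕ) :
    {z : Fin n → Y // Function.Injective z ∧ ∀ i, z i ∈ x.pts} ≃ (Fin n ↪ x.pts) where
  toFun z := ⟨fun i => ⟨z.1 i, z.2.2 i⟩, fun _ _ h => z.2.1 (Subtype.ext_iff.1 h)⟩
  invFun e := ⟨fun i => e i, fun _ _ h => e.injective (Subtype.ext h), fun i => (e i).2⟩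
  left_inv _ := rfl
  right_inv _ := rfl

theorem distinctSum_prod (x : Config Y) (w : Y → ℝ≥0∞) (n : ℕ) :
    distinctSum x n (fun z => ∏ i, w (z i)) =
      n.factorial * esymmSum (fun p : x.pts => w p) n := by
  rw [← tsum_embedding_prod, distinctSum, ← (distinctEmbeddingEquiv x n).symm.tsum_eq]
  rfl

open Classical in
theorem distinctSum_erase (x : Config Y) (p : Y) (n : ℕ) (f : (Fin n → Y) → ℝ≥0∞) :
    distinctSum (x.erase p) n f = distinctSum x n fun z => if p ∈ Set.range z then 0 else f z := by
  refine (tsum_subtype {z : Fin n → Y | Function.Injective z ∧ ∀ i, z i ∈ (x.erase p).pts}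
    f).trans (Eq.trans (tsum_congr fun z => ?_)
      (tsum_subtype {z : Fin n → Y | Function.Injective z ∧ ∀ i, z i ∈ x.pts}
        fun z => if p ∈ Set.range z then 0 else f z).symm)
  have : (Function.Injective z ∧ ∀ i, z i ∈ (x.erase p).pts) ↔
      (Function.Injective z ∧ ∀ i, z i ∈ x.pts) ∧ p ∉ Set.range z := by
    simp only [Config.erase, Config.pts, Set.mem_sdiff, Set.mem_singleton_iff, Set.mem_range,
      not_exists, forall_and, and_assoc]
  simp only [Set.indicator, Set.mem_ofPred_eq, this]
  split_ifs <;> simp_all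

/-- A factorial power sum is bounded in terms of the next one. -/
theorem distinctSum_prod_le_succ (x : Config Y) {w : Y → ℝ≥0∞} (hw : ∀ p, w p ≤ 1) (n : ℕ) :
    distinctSum x n (fun z => ∏ i, w (z i)) ≤
      ((n + 1 : ℕ) : ℝ≥0∞) ^ n + distinctSum x (n + 1) fun z => ∏ i, w (z i) := by
  classical
  set S : ℝ≥0∞ := ∑' p : x.pts, w p with hS
  have hle : ∀ (n : ℕ) (x' : Config Y), x'.pts ⊆ x.pts →
      distinctSum x' n (fun z => ∏ i, w (z i)) ≤ S ^ n := by
    intro n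
    induction n with
    | zero => intro x' _; simp [distinctSum_zero]
    | succ n ih =>
      intro x' hx'
      rw [distinctSum_succ]
      have : ∀ p : x'.pts, distinctSum (x'.erase p) n
          (fun z => ∏ i, w ((Fin.cons (p : Y) z : Fin (n + 1) → Y) i)) ≤ w p * S ^ n := fun p => by
        simp_rw [Fin.prod_univ_succ, Fin.cons_zero, Fin.cons_succ]
        unfold distinctSum
        rw [ENNReal.tsum_mul_left]
        exact mul_le_mul_right (ih _ (Set.sdiff_subset.trans hx')) _
      refine (ENNReal.tsum_le_tsum this).trans ?_
      rw [ENNReal.tsum_mul_right, pow_succ, mul_comm]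
      exact mul_le_mul_right (ENNReal.tsum_mono_subtype w hx') _
  -- If the total weight `S` is below `n + 1`, the sum is at most `Sⁿ`. Otherwise the points off a
  -- given `n`-tuple have weight at least `1`, because its `n` points carry weight at most `n`; so
  -- adjoining a further point cannot decrease the sum.
  rcases lt_or_ge S ((n + 1 : ℕ) : ℝ≥0∞) with h | h
  · exact (hle n x subset_rfl).trans ((pow_le_pow_left' h.le n).trans le_self_add)
  · refine le_trans ?_ le_add_self
    rw [distinctSum_succ]
    simp_rw [distinctSum_erase, Fin.prod_univ_succ, Fin.cons_zero, Fin.cons_succ]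
    unfold distinctSum
    rw [ENNReal.tsum_comm]
    refine ENNReal.tsum_le_tsum fun z => ?_
    have hz : ∀ p : x.pts, (if (p : Y) ∈ Set.range z.1 then 0 else w p * ∏ i, w (z.1 i)) =
        (if (p : Y) ∈ Set.range z.1 then 0 else w p) * ∏ i, w (z.1 i) := fun p => by
      split_ifs <;> simp
    simp_rw [hz]
    rw [ENNReal.tsum_mul_right]
    refine le_mul_of_one_le_left' ?_
    set G : Finset x.pts := Finset.univ.image fun i => (⟨z.1 i, z.2.2 i⟩ : x.pts) with hG
    have hGc : G.card ≤ n := Finset.card_image_le.trans (by simp)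
    have hsplit : S ≤ ∑' p : x.pts, (if (p : Y) ∈ Set.range z.1 then 0 else w p) + n := by
      have h1 : S ≤ ∑' p : x.pts, ((if (p : Y) ∈ Set.range z.1 then 0 else w p) +
          if p ∈ G then 1 else 0) := by
        refine ENNReal.tsum_le_tsum fun p => ?_
        by_cases hp : (p : Y) ∈ Set.range z.1
        · obtain ⟨i, hi⟩ := hp
          have : p ∈ G := Finset.mem_image.2 ⟨i, Finset.mem_univ i, Subtype.ext hi⟩
          simpa [this] using (hw p).trans le_add_self
        · simp [hp]
      refine h1.trans ?_
      rw [ENNReal.tsum_add]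
      refine add_le_add_right ?_ _
      rw [tsum_eq_sum (s := G) fun p hp => by simp [hp]]
      simpa using hGc
    have h2 : (1 : ℝ≥0∞) + n ≤ ∑' p : x.pts, (if (p : Y) ∈ Set.range z.1 then 0 else w p) + n := by
      refine le_trans ?_ (h.trans hsplit)
      push_cast
      rw [add_comm]
    exact (ENNReal.add_le_add_iff_right (ENNReal.natCast_ne_top n)).1 h2

end DistinctSumProd

/-! ### Expected products over a point process -/

section ExpectedProducts

universe u

variable {Y : Type u} [MetricSpace Y] [SecondCountableTopology Y] [MeasurableSpace Y]
  [OpensMeasurableSpace Y] {Ω : Type*} [MeasurableSpace Ω] {μ : Measure Ω}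
  {X : Ω → Config Y} {u : Y → ℝ}

/-- The expected elementary symmetric sum `𝔼 ∑^{≠} u(x₁) ⋯ u(xₙ) / n!`. -/
noncomputable def expectedEsymm (μ : Measure Ω) (X : Ω → Config Y) (u : Y → ℝ) (n : ℕ) : ℝ≥0∞ :=
  ∫⁻ ω, esymmSum (fun p : (X ω).pts => ENNReal.ofReal (u p)) n ∂μ

omit [SecondCountableTopology Y] [OpensMeasurableSpace Y] in
theorem esymmSum_eq_distinctSum (x : Config Y) (w : Y → ℝ≥0∞) (n : ℕ) :
    esymmSum (fun p : x.pts => w p) n =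
      (n.factorial : ℝ≥0∞)⁻¹ * distinctSum x n fun z => ∏ i, w (z i) := by
  rw [distinctSum_prod, ← mul_assoc, ENNReal.inv_mul_cancel, one_mul]
  · exact Nat.cast_ne_zero.2 n.factorial_ne_zero
  · exact ENNReal.natCast_ne_top _

theorem measurable_distinctSum_prod (hX : Measurable X) (hu : Measurable u) (n : ℕ) :
    Measurable fun ω => distinctSum (X ω) n fun z => ∏ i, ENNReal.ofReal (u (z i)) := by
  have h : Measurable fun x : Config Y => distinctSum x n fun z => ∏ i, ENNReal.ofReal (u (z i)) :=
    measurable_distinctSum measurable_id (f := fun _ z => ∏ i, ENNReal.ofReal (u (z i)))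
      (Finset.measurable_prod _ fun i _ =>
        (hu.comp ((measurable_pi_apply i).comp measurable_snd)).ennreal_ofReal)
  exact h.comp hX

theorem measurable_esymmSum (hX : Measurable X) (hu : Measurable u) (n : ℕ) :
    Measurable fun ω => esymmSum (fun p : (X ω).pts => ENNReal.ofReal (u p)) n := by
  simp_rw [esymmSum_eq_distinctSum _ fun p => ENNReal.ofReal (u p)]
  exact (measurable_distinctSum_prod hX hu n).const_mul _

theorem expectedEsymm_eq (hX : Measurable X) (hu : Measurable u) (n : ℕ) :
    expectedEsymm μ X u n = (n.factorial : ℝ≥0∞)⁻¹ *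
      ∫⁻ ω, distinctSum (X ω) n (fun z => ∏ i, ENNReal.ofReal (u (z i))) ∂μ := by
  rw [← lintegral_const_mul _ (measurable_distinctSum_prod hX hu n)]
  exact lintegral_congr fun ω => esymmSum_eq_distinctSum _ (fun p => ENNReal.ofReal (u p)) n

omit [SecondCountableTopology Y] [OpensMeasurableSpace Y] in
theorem expectedEsymm_zero : expectedEsymm μ X u 0 = μ Set.univ := by
  have : ∀ ω, esymmSum (fun p : (X ω).pts => ENNReal.ofReal (u p)) 0 = 1 := fun ω => by
    rw [esymmSum_eq_distinctSum _ fun p => ENNReal.ofReal (u p)]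
    simp [distinctSum_zero]
  simp [expectedEsymm, this]

/-- A root test controls only large orders; this propagates finiteness down to the initial terms. -/
theorem expectedEsymm_ne_top_of_succ [IsFiniteMeasure μ] (hX : Measurable X) (hu : Measurable u)
    (hu1 : ∀ p, u p ≤ 1) {n : ℕ} (h : expectedEsymm μ X u (n + 1) ≠ ∞) :
    expectedEsymm μ X u n ≠ ∞ := by
  rw [expectedEsymm_eq hX hu] at h ⊢
  have hfac : ∀ k : ℕ, (k.factorial : ℝ≥0∞)⁻¹ ≠ 0 ∧ (k.factorial : ℝ≥0∞)⁻¹ ≠ ∞ := fun k =>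
    ⟨ENNReal.inv_ne_zero.2 (ENNReal.natCast_ne_top _),
      ENNReal.inv_ne_top.2 (Nat.cast_ne_zero.2 k.factorial_ne_zero)⟩
  have h' : ∫⁻ ω, distinctSum (X ω) (n + 1) (fun z => ∏ i, ENNReal.ofReal (u (z i))) ∂μ ≠ ∞ :=
    fun hh => h (by rw [hh, ENNReal.mul_top (hfac _).1])
  refine ENNReal.mul_ne_top (hfac n).2 (ne_top_of_le_ne_top ?_ (lintegral_mono fun ω =>
    distinctSum_prod_le_succ (X ω) (w := fun p => ENNReal.ofReal (u p))
      (fun p => ENNReal.ofReal_le_one.2 (hu1 p)) n))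
  rw [lintegral_add_left measurable_const, lintegral_const]
  exact ENNReal.add_ne_top.2 ⟨ENNReal.mul_ne_top (ENNReal.pow_ne_top (ENNReal.natCast_ne_top _))
    (measure_ne_top μ _), h'⟩

/-- The expansion is integrated termwise. Measurability of the infinite product is part of the
conclusion, since it is obtained from almost everywhere equality with the measurable series. -/
theorem integral_pointProd_one_sub_mul (hX : Measurable X)
    (hu : Measurable u) (hu0 : ∀ p, 0 ≤ u p) {s : ℝ} (hs : 0 ≤ s)
    (hfin : ∑' n, ENNReal.ofReal (s ^ n) * expectedEsymm μ X u n ≠ ∞)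
    (htop : ∀ n, expectedEsymm μ X u n ≠ ∞) :
    AEStronglyMeasurable (fun ω => pointProd (X ω) fun p => 1 - s * u p) μ ∧
      ∫ ω, pointProd (X ω) (fun p => 1 - s * u p) ∂μ =
        ∑' n, (-s) ^ n * (expectedEsymm μ X u n).toReal := by
  set e : ℕ → Ω → ℝ≥0∞ := fun n ω => esymmSum (fun p : (X ω).pts => ENNReal.ofReal (u p)) n with he
  have hem : ∀ n, Measurable (e n) := fun n => measurable_esymmSum hX hu n
  have hint : ∀ n, ∫⁻ ω, e n ω ∂μ = expectedEsymm μ X u n := fun n => rfl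
  have hsum : ∫⁻ ω, ∑' n, ENNReal.ofReal (s ^ n) * e n ω ∂μ ≠ ∞ := by
    rw [lintegral_tsum fun n => ((hem n).const_mul _).aemeasurable]
    simpa only [lintegral_const_mul _ (hem _), hint] using hfin
  have hae : ∀ᵐ ω ∂μ, ∑' n, ENNReal.ofReal (s ^ n) * e n ω < ∞ :=
    ae_lt_top (Measurable.tsum fun n => (hem n).const_mul _) hsum
  have hexp : (fun ω => pointProd (X ω) fun p => 1 - s * u p) =ᵐ[μ]
      fun ω => ∑' n, (-s) ^ n * (e n ω).toReal := by
    filter_upwards [hae] with ω hω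
    exact tprod_one_sub_mul_eq_tsum (f := fun p : (X ω).pts => u p) (fun p => hu0 p) hs hω.ne
  have hterm : ∀ n, AEStronglyMeasurable (fun ω => (-s) ^ n * (e n ω).toReal) μ := fun n =>
    ((hem n).ennreal_toReal.const_mul _).aestronglyMeasurable
  refine ⟨?_, ?_⟩
  · refine AEStronglyMeasurable.congr ?_ hexp.symm
    exact (Measurable.tsum fun n => (hem n).ennreal_toReal.const_mul ((-s) ^ n)).aestronglyMeasurable
  · rw [integral_congr_ae hexp, integral_tsum hterm]
    · refine tsum_congr fun n => ?_
      rw [integral_const_mul, integral_toReal (hem n).aemeasurable (ae_lt_top (hem n) (htop n))]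
      rfl
    · refine ne_top_of_le_ne_top hfin (ENNReal.tsum_le_tsum fun n => ?_)
      rw [← hint, ← lintegral_const_mul _ (hem n)]
      refine lintegral_mono fun ω => ?_
      rw [enorm_mul, enorm_pow, enorm_neg, Real.enorm_of_nonneg hs, ← ENNReal.ofReal_pow hs,
        Real.enorm_of_nonneg ENNReal.toReal_nonneg]
      exact mul_le_mul_right ENNReal.ofReal_toReal_le _

/-- If the expected elementary symmetric sums have generating function with radius of convergence
at least `1`, then the expected product `𝔼 ∏ (1 - u)` is the Abel sum of the alternating series. -/
theorem tendsto_tsum_expectedEsymm [IsFiniteMeasure μ] (hX : Measurable X)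
    (hu : Measurable u) (hu0 : ∀ p, 0 ≤ u p) (hu1 : ∀ p, u p ≤ 1)
    (hfin : ∀ s ∈ Set.Ioo (0 : ℝ) 1,
      ∑' n, ENNReal.ofReal (s ^ n) * expectedEsymm μ X u n ≠ ∞) :
    Integrable (fun ω => pointProd (X ω) fun p => 1 - u p) μ ∧
      Tendsto (fun s : ℝ => ∑' n, (-s) ^ n * (expectedEsymm μ X u n).toReal) (𝓝[<] 1)
        (𝓝 (∫ ω, pointProd (X ω) (fun p => 1 - u p) ∂μ)) := by
  -- At `s = 1/2` the weight `sⁿ` is positive, so an infinite coefficient would make the series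
  -- infinite.
  have htop : ∀ n, expectedEsymm μ X u n ≠ ∞ := fun n h => by
    refine ENNReal.ne_top_of_tsum_ne_top (hfin (1 / 2) ⟨by norm_num, by norm_num⟩) n ?_
    rw [h, ENNReal.mul_top]
    simp
  have hs : ∀ᶠ s : ℝ in 𝓝[<] 1, s ∈ Set.Ioo (0 : ℝ) 1 := Ioo_mem_nhdsLT one_pos
  have hprod := fun s (hs : s ∈ Set.Ioo (0 : ℝ) 1) =>
    integral_pointProd_one_sub_mul hX hu hu0 hs.1.le (hfin s hs) htop
  have hlim : ∀ ω, Tendsto (fun s : ℝ => pointProd (X ω) fun p => 1 - s * u p) (𝓝[<] 1)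
      (𝓝 (pointProd (X ω) fun p => 1 - u p)) := fun ω =>
    tendsto_tprod_one_sub_mul (fun p => hu0 p) fun p => hu1 p
  have hnorm : ∀ ω, ∀ s : ℝ, 0 ≤ s → s ≤ 1 → ‖pointProd (X ω) fun p => 1 - s * u p‖ ≤ 1 := by
    intro ω s h0 h1
    have a0 : ∀ p : (X ω).pts, 0 ≤ 1 - s * u p := fun p =>
      sub_nonneg.2 (mul_le_one₀ h1 (hu0 p) (hu1 p))
    have a1 : ∀ p : (X ω).pts, 1 - s * u p ≤ 1 := fun p => sub_le_self _ (mul_nonneg h0 (hu0 p))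
    rw [pointProd, Real.norm_of_nonneg (tprod_nonneg_unitInterval a0 a1)]
    exact tprod_le_one_unitInterval a0 a1
  -- At `s = 1` the expansion may diverge; measurability is inherited as a pointwise limit along a
  -- sequence increasing to `1`.
  have hmeas : AEStronglyMeasurable (fun ω => pointProd (X ω) fun p => 1 - u p) μ := by
    obtain ⟨v, -, hv, hvl⟩ := exists_seq_strictMono_tendsto' (show (0 : ℝ) < 1 from one_pos)
    refine aestronglyMeasurable_of_tendsto_ae (u := atTop)
      (f := fun k ω => pointProd (X ω) fun p => 1 - v k * u p) (fun k => (hprod _ (hv k)).1) ?_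
    refine Eventually.of_forall fun ω => (hlim ω).comp ?_
    exact tendsto_nhdsWithin_iff.2 ⟨hvl, Eventually.of_forall fun k => (hv k).2⟩
  refine ⟨?_, ?_⟩
  · refine Integrable.of_bound hmeas 1 (Eventually.of_forall fun ω => ?_)
    simpa using hnorm ω 1 zero_le_one le_rfl
  · have h := tendsto_integral_filter_of_dominated_convergence (μ := μ) (l := 𝓝[<] (1 : ℝ))
      (F := fun s ω => pointProd (X ω) fun p => 1 - s * u p)
      (f := fun ω => pointProd (X ω) fun p => 1 - u p) (fun _ => (1 : ℝ))
      (hs.mono fun s hs => (hprod s hs).1)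
      (hs.mono fun s hs => Eventually.of_forall fun ω => hnorm ω s hs.1.le hs.2.le)
      (integrable_const 1) (Eventually.of_forall hlim)
    exact h.congr' (hs.mono fun s hs => (hprod s hs).2)

end ExpectedProducts

/-! ### Rotation invariance on the sphere -/

section Sphere

/-- A rotation matrix as a linear isometry. -/
noncomputable def rotIsometry (O : Rot) :
    EuclideanSpace ℝ (Fin 3) ≃ₗᵢ[ℝ] EuclideanSpace ℝ (Fin 3) :=
  LinearIsometry.toLinearIsometryEquiv
    ⟨Matrix.toEuclideanLin (O : Matrix (Fin 3) (Fin 3) ℝ), fun x => norm_rotate O x⟩ rfl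

theorem coe_rotate (O : Rot) (x : S2) :
    (rotate O x : EuclideanSpace ℝ (Fin 3)) = rotIsometry O x := rfl

theorem continuous_rotate (O : Rot) : Continuous (rotate O) :=
  Continuous.subtype_mk ((rotIsometry O).continuous.comp continuous_subtype_val) _

theorem rotate_preimage_geoBall (O : Rot) (y : S2) (r : ℝ) :
    rotate O ⁻¹' geoBall (rotate O y) r = geoBall y r := by
  ext x
  change InnerProductGeometry.angle (rotIsometry O y) (rotIsometry O x) ≤ r ↔
    InnerProductGeometry.angle (y : EuclideanSpace ℝ (Fin 3)) x ≤ r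
  rw [← LinearIsometryEquiv.coe_toLinearIsometry, LinearIsometry.angle_map]

theorem measurableSet_geoBall (y : S2) (r : ℝ) : MeasurableSet (geoBall y r) := by
  have : Measurable fun x : S2 =>
      InnerProductGeometry.angle (y : EuclideanSpace ℝ (Fin 3)) (x : EuclideanSpace ℝ (Fin 3)) := by
    unfold InnerProductGeometry.angle
    fun_prop
  exact this measurableSet_Iic

instance : IsFiniteMeasure surf := inferInstanceAs (IsFiniteMeasure (Measure.toSphere _))

-- Surface measure is, up to a constant, the volume of the cone over a set, and a rotation carries
-- cones to cones while preserving Lebesgue measure.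
open scoped Pointwise in
theorem measurePreserving_rotate (O : Rot) : MeasurePreserving (rotate O) surf surf := by
  refine ⟨(continuous_rotate O).measurable, ?_⟩
  ext s hs
  have hpre : MeasurableSet (rotate O ⁻¹' s) := (continuous_rotate O).measurable hs
  rw [Measure.map_apply (continuous_rotate O).measurable hs, surf, Measure.toSphere_apply' _ hpre,
    Measure.toSphere_apply' _ hs,
    ← (rotIsometry O).measurePreserving.measure_preimage_emb
      (rotIsometry O).toHomeomorph.measurableEmbedding (Set.Ioo (0 : ℝ) 1 • Subtype.val '' s)]
  congr 2
  ext v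
  simp only [Set.mem_preimage, Set.mem_smul, Set.mem_image, Subtype.exists]
  constructor
  · rintro ⟨t, ht, _, ⟨x, hx, hxs, rfl⟩, rfl⟩
    exact ⟨t, ht, rotIsometry O x, ⟨_, (rotate O ⟨x, hx⟩).2, hxs, rfl⟩, by simp⟩
  · rintro ⟨t, ht, _, ⟨x, hx, hxs, rfl⟩, hv⟩
    have hmem : (rotIsometry O).symm x ∈ Metric.sphere (0 : EuclideanSpace ℝ (Fin 3)) 1 := by
      simpa using hx
    refine ⟨t, ht, (rotIsometry O).symm x, ⟨_, hmem, ?_, rfl⟩, ?_⟩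
    · have : rotate O ⟨(rotIsometry O).symm x, hmem⟩ = ⟨x, hx⟩ :=
        Subtype.ext (by simp [coe_rotate])
      rwa [this]
    · apply (rotIsometry O).injective
      rw [← hv]
      simp

variable {M : Type*} [MeasurableSpace M]

theorem measurePreserving_rotate_tuple (ν : Measure M) [SigmaFinite ν] (O : Rot) (y : S2)
    (r : ℝ) {E : Set M} (hE : MeasurableSet E) (n : ℕ) :
    MeasurePreserving (fun (z : Fin n → S2 × M) i => (rotate O (z i).1, (z i).2))
      (Measure.pi fun _ => (surf.prod ν).restrict (geoBall y r ×ˢ E))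
      (Measure.pi fun _ => (surf.prod ν).restrict (geoBall (rotate O y) r ×ˢ E)) := by
  have h1 : MeasurePreserving (Prod.map (rotate O) id) (surf.prod ν) (surf.prod ν) :=
    (measurePreserving_rotate O).prod (MeasurePreserving.id ν)
  have h2 := h1.restrict_preimage ((measurableSet_geoBall (rotate O y) r).prod hE)
  rw [Set.preimage_prod_map_prod, rotate_preimage_geoBall, Set.preimage_id] at h2
  have : ∀ _ : Fin n, SigmaFinite ((surf.prod ν).restrict (geoBall (rotate O y) r ×ˢ E)) :=
    fun _ => inferInstance
  exact measurePreserving_pi (hν := this) _ _ fun _ => h2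

end Sphere

/-! ### Sums over partitions -/

section PartitionSums

variable {α β : Type*} [DecidableEq α] [DecidableEq β]

/-- The sum over all partitions of a finite set of the products over the blocks. -/
noncomputable def partitionSum (Ξ : Finset α → ℝ) (A : Finset α) : ℝ :=
  ∑ π : Finpartition A, ∏ B ∈ π.parts, Ξ B

theorem partitionSum_empty (Ξ : Finset α → ℝ) : partitionSum Ξ ∅ = 1 := by
  unfold partitionSum
  have : Unique (Finpartition (∅ : Finset α)) :=
    inferInstanceAs (Unique (Finpartition (⊥ : Finset α)))
  rw [Fintype.sum_unique]
  have h : (default : Finpartition (∅ : Finset α)).parts = ∅ :=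
    Finpartition.parts_eq_empty_iff.2 rfl
  rw [h, Finset.prod_empty]

/-- Removing a block from a partition. -/
def eraseBlock {A B : Finset α} (π : Finpartition A) (hB : B ∈ π.parts) :
    Finpartition (A \ B) where
  parts := π.parts.erase B
  supIndep := π.supIndep.subset (Finset.erase_subset _ _)
  sup_parts := by
    ext x
    simp only [Finset.mem_sup, Finset.mem_erase, id, Finset.mem_sdiff]
    constructor
    · rintro ⟨D, ⟨hne, hD⟩, hx⟩
      exact ⟨π.le hD hx, fun hxB => hne (π.eq_of_mem_parts hD hB hx hxB)⟩
    · rintro ⟨hxA, hxB⟩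
      obtain ⟨D, hD, hx⟩ := π.exists_mem hxA
      exact ⟨D, ⟨fun h => hxB (h ▸ hx), hD⟩, hx⟩
  bot_notMem h := π.bot_notMem (Finset.mem_of_mem_erase h)

/-- The recursion for sums over partitions: split off the block of a given element. -/
theorem partitionSum_eq_sum_block (Ξ : Finset α → ℝ) {A : Finset α} {i : α} (hi : i ∈ A) :
    partitionSum Ξ A =
      ∑ B ∈ A.powerset.filter (fun B => i ∈ B), Ξ B * partitionSum Ξ (A \ B) := by
  have hmaps : ∀ π ∈ (Finset.univ : Finset (Finpartition A)),
      π.part i ∈ A.powerset.filter fun B => i ∈ B := fun π _ =>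
    Finset.mem_filter.2 ⟨Finset.mem_powerset.2 (π.le (π.part_mem.2 hi)), π.mem_part hi⟩
  rw [partitionSum, ← Finset.sum_fiberwise_of_maps_to hmaps]
  refine Finset.sum_congr rfl fun B hB => ?_
  obtain ⟨hBA, hiB⟩ := Finset.mem_filter.1 hB
  rw [Finset.mem_powerset] at hBA
  have hmem : ∀ π ∈ (Finset.univ : Finset (Finpartition A)).filter (fun π => π.part i = B),
      B ∈ π.parts := fun π hπ => (Finset.mem_filter.1 hπ).2 ▸ π.part_mem.2 hi
  have hBne : B ≠ ⊥ := Finset.nonempty_iff_ne_empty.1 ⟨i, hiB⟩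
  have hdis : Disjoint (A \ B) B := Finset.sdiff_disjoint
  have hsup : (A \ B) ⊔ B = A := Finset.sdiff_union_of_subset hBA
  have hnot : ∀ σ : Finpartition (A \ B), B ∉ σ.parts := fun σ h =>
    (Finset.mem_sdiff.1 (σ.le h hiB)).2 hiB
  rw [partitionSum, Finset.mul_sum]
  refine Finset.sum_bij' (fun π hπ => eraseBlock π (hmem π hπ))
    (fun σ _ => σ.extend hBne hdis hsup) (fun _ _ => Finset.mem_univ _) (fun σ _ => ?_)
    (fun π hπ => ?_) (fun σ _ => ?_) (fun π hπ => ?_)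
  · refine Finset.mem_filter.2 ⟨Finset.mem_univ _, ?_⟩
    exact Finpartition.part_eq_of_mem _ (Finset.mem_insert_self _ _) hiB
  · refine Finpartition.ext ?_
    exact Finset.insert_erase (hmem π hπ)
  · refine Finpartition.ext ?_
    exact Finset.erase_insert (hnot σ)
  · exact (Finset.mul_prod_erase _ _ (hmem π hπ)).symm

/-- Induction through the block recursion replaces a direct transport of partitions along `e`. -/
theorem partitionSum_map (Ξ : Finset β → ℝ) (e : α ↪ β) (A : Finset α) :
    partitionSum Ξ (A.map e) = partitionSum (fun B => Ξ (B.map e)) A := by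
  induction A using Finset.strongInduction with
  | H A ih =>
    rcases A.eq_empty_or_nonempty with rfl | ⟨i, hi⟩
    · rw [Finset.map_empty, partitionSum_empty, partitionSum_empty]
    rw [partitionSum_eq_sum_block _ hi,
      partitionSum_eq_sum_block _ (Finset.mem_map_of_mem e hi)]
    symm
    refine Finset.sum_bij (fun B _ => B.map e) (fun B hB => ?_) (fun B _ D _ h => ?_)
      (fun D hD => ?_) (fun B hB => ?_)
    · simp only [Finset.mem_filter, Finset.mem_powerset] at hB ⊢
      exact ⟨Finset.map_subset_map.2 hB.1, Finset.mem_map_of_mem e hB.2⟩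
    · exact Finset.map_injective e h
    · simp only [Finset.mem_filter, Finset.mem_powerset] at hD
      obtain ⟨B, hB, rfl⟩ := Finset.subset_map_iff.1 hD.1
      refine ⟨B, ?_, rfl⟩
      simp only [Finset.mem_filter, Finset.mem_powerset]
      exact ⟨hB, (Finset.mem_map' e).1 hD.2⟩
    · simp only [Finset.mem_filter, Finset.mem_powerset] at hB
      have hsub : A \ B ⊂ A := Finset.sdiff_ssubset hB.1 ⟨i, hB.2⟩
      rw [← ih _ hsub]
      congr 2
      ext b
      simp only [Finset.mem_map, Finset.mem_sdiff]
      constructor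
      · rintro ⟨a, ⟨ha, haB⟩, rfl⟩
        exact ⟨⟨a, ha, rfl⟩, fun ⟨c, hc, h⟩ => haB (e.injective h ▸ hc)⟩
      · rintro ⟨⟨a, ha, rfl⟩, h⟩
        exact ⟨a, ⟨ha, fun haB => h ⟨a, haB, rfl⟩⟩, rfl⟩

end PartitionSums

/-! ### The recursion between intensity ratios and correlation functions -/

section CorrelationRecursion

variable {Y : Type*} (ρ : (n : ℕ) → (Fin n → Y) → ℝ≥0)

/-- The correlation function of the subfamily of `z` with indices in `A`. -/
noncomputable def blockCorrelation {N : ℕ} (z : Fin N → Y) (A : Finset (Fin N)) : ℝ :=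
  correlation ρ A.card fun j => z (A.orderEmbOfFin rfl j)

/-- The ratio `ρ⁽ⁿ⁾ / (ρ ⋯ ρ)`, with value `1` for `n = 0`. -/
noncomputable def normRatio (n : ℕ) (z : Fin n → Y) : ℝ :=
  if n = 0 then 1 else rhoRatio ρ n z

/-- The increasing enumeration of a finite set is unique. This permits replacing the length
`A.card`, on which the type of the tuple depends, by `m`. -/
theorem apply_orderEmbOfFin {N : ℕ} {γ : Type*} (g : (n : ℕ) → (Fin n → Y) → γ) (z : Fin N → Y)
    {A : Finset (Fin N)} {m : ℕ} {f : Fin m → Fin N} (hf : StrictMono f)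
    (hA : A = Finset.univ.map ⟨f, hf.injective⟩) :
    g A.card (fun j => z (A.orderEmbOfFin rfl j)) = g m fun j => z (f j) := by
  have hcard : A.card = m := by rw [hA, Finset.card_map, Finset.card_univ, Fintype.card_fin]
  subst hcard
  congr 1
  funext j
  congr 1
  refine (congrFun (Finset.orderEmbOfFin_unique rfl (fun x => ?_) hf) j).symm
  exact hA.symm.subset (Finset.mem_map_of_mem ⟨f, hf.injective⟩ (Finset.mem_univ x))

theorem blockCorrelation_map {N k : ℕ} (z : Fin N → Y) (e : Fin k ↪o Fin N)
    (B : Finset (Fin k)) :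
    blockCorrelation ρ z (B.map e.toEmbedding) = blockCorrelation ρ (fun j => z (e j)) B := by
  refine apply_orderEmbOfFin (correlation ρ) z (f := fun j => e (B.orderEmbOfFin rfl j))
    (e.strictMono.comp (B.orderEmbOfFin rfl).strictMono) ?_
  conv_lhs => rw [← Finset.map_orderEmbOfFin_univ B rfl, Finset.map_map]
  rfl

theorem rhoRatio_one {ρ : (n : ℕ) → (Fin n → Y) → ℝ≥0} (hpos : ∀ p, rho ρ p ≠ 0)
    (z : Fin 1 → Y) : rhoRatio ρ 1 z = 1 := by
  have h : ρ 1 z = rho ρ (z 0) := by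
    rw [rho]
    congr 1
    funext i
    rw [Subsingleton.elim i 0]
  rw [rhoRatio, Fin.prod_univ_one, h, div_self]
  exact NNReal.coe_ne_zero.2 (hpos _)

theorem correlation_one (z : Fin 1 → Y) : correlation ρ 1 z = 1 := by
  rw [correlation, if_pos rfl]

/-- The defining equation covers `k ≥ 2`. For `k = 1` it holds since `ξ₁ = 1` and `ρ/ρ = 1`, which
uses positivity; for `k = 0` the empty partition gives `1`, the reason for the convention in
`normRatio`. -/
theorem partitionSum_univ {ρ : (n : ℕ) → (Fin n → Y) → ℝ≥0} (hpos : ∀ p, rho ρ p ≠ 0) {k : ℕ}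
    (z : Fin k → Y) : partitionSum (blockCorrelation ρ z) Finset.univ = normRatio ρ k z := by
  rcases k with _ | _ | k
  · rw [Finset.univ_eq_empty, partitionSum_empty, normRatio, if_pos rfl]
  · rw [normRatio, if_neg (by omega), show rhoRatio ρ (0 + 1) z = 1 from rhoRatio_one hpos z,
      partitionSum_eq_sum_block _ (Finset.mem_univ 0)]
    have hfil : (Finset.univ : Finset (Fin (0 + 1))).powerset.filter (fun B => 0 ∈ B) =
        {Finset.univ} := by decide
    rw [hfil, Finset.sum_singleton, sdiff_self]
    change _ * partitionSum _ ∅ = 1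
    rw [partitionSum_empty, mul_one]
    exact correlation_one ρ _
  · rw [normRatio, if_neg (by omega), ← sum_partitions_correlation ρ (by omega) z, partitionSum]
    refine Finset.sum_congr rfl fun π _ => ?_
    exact (Finset.prod_coe_sort π.parts (blockCorrelation ρ z)).symm

theorem partitionSum_blockCorrelation {ρ : (n : ℕ) → (Fin n → Y) → ℝ≥0}
    (hpos : ∀ p, rho ρ p ≠ 0) {N : ℕ} (z : Fin N → Y) (A : Finset (Fin N)) :
    partitionSum (blockCorrelation ρ z) A =
      normRatio ρ A.card fun j => z (A.orderEmbOfFin rfl j) := by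
  conv_lhs => rw [← Finset.map_orderEmbOfFin_univ A rfl, partitionSum_map]
  rw [← partitionSum_univ hpos]
  congr 1
  funext B
  exact blockCorrelation_map ρ z _ B

/-- The Palm-type recursion
`ρ⁽ⁿ⁺¹⁾(p, z) / (ρ ⋯ ρ) = ∑_{D} ξ_{|D|+1}(p, z_D) · ρ⁽ⁿ⁻ᴰ⁾(z_{Dᶜ}) / (ρ ⋯ ρ)`. -/
theorem rhoRatio_cons_eq_sum {ρ : (n : ℕ) → (Fin n → Y) → ℝ≥0} (hpos : ∀ p, rho ρ p ≠ 0)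
    {n : ℕ} (p : Y) (z : Fin n → Y) :
    rhoRatio ρ (n + 1) (Fin.cons p z) =
      ∑ D : Finset (Fin n),
        correlation ρ (D.card + 1) (Fin.cons p fun j => z (D.orderEmbOfFin rfl j)) *
          normRatio ρ Dᶜ.card fun j => z (Dᶜ.orderEmbOfFin rfl j) := by
  have h := partitionSum_univ hpos (Fin.cons p z : Fin (n + 1) → Y)
  rw [normRatio, if_neg (by omega)] at h
  -- The block of index `0`, which carries `p`, is `{0}` together with a shifted set `D`; the
  -- partitions of the remaining indices sum up to the ratio on `Dᶜ`.
  rw [← h, partitionSum_eq_sum_block _ (Finset.mem_univ 0)]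
  symm
  have hsucc0 : ∀ D : Finset (Fin n), (0 : Fin (n + 1)) ∉ D.map (Fin.succEmb n) := fun D h0 => by
    obtain ⟨i, -, hi⟩ := Finset.mem_map.1 h0
    exact Fin.succ_ne_zero i hi
  refine Finset.sum_bij (fun D _ => insert 0 (D.map (Fin.succEmb n))) (fun D _ => by simp)
    (fun B _ D _ hBD => ?_) (fun B hB => ?_) (fun D _ => ?_)
  · have := congrArg (fun S => S.erase 0) hBD
    simp only [Finset.erase_insert (hsucc0 _)] at this
    exact Finset.map_injective _ this
  · have h0 : 0 ∈ B := (Finset.mem_filter.1 hB).2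
    refine ⟨Finset.univ.filter fun i => Fin.succ i ∈ B, Finset.mem_univ _, ?_⟩
    ext i
    refine Fin.cases (by simp [h0]) (fun i => ?_) i
    simp [Fin.succ_ne_zero]
  · congr 1
    · set f : Fin (D.card + 1) → Fin (n + 1) :=
        Fin.cons 0 fun j => (D.orderEmbOfFin rfl j).succ with hf
      have hmono : StrictMono f := by
        intro a b hab
        induction a using Fin.cases with
        | zero =>
          induction b using Fin.cases with
          | zero => exact absurd hab (lt_irrefl _)
          | succ b => simp [hf]
        | succ a =>
          induction b using Fin.cases with
          | zero => exact absurd hab (Fin.not_lt_zero _)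
          | succ b =>
            simp only [hf, Fin.cons_succ]
            exact Fin.succ_lt_succ_iff.2
              ((D.orderEmbOfFin rfl).strictMono (Fin.succ_lt_succ_iff.1 hab))
      have himg : insert 0 (D.map (Fin.succEmb n)) = Finset.univ.map ⟨f, hmono.injective⟩ := by
        conv_lhs => rw [← Finset.map_orderEmbOfFin_univ D rfl]
        ext i
        simp only [Finset.mem_insert, Finset.mem_map, Finset.mem_univ, true_and,
          Function.Embedding.coeFn_mk, Fin.exists_fin_succ, hf, Fin.cons_zero, Fin.cons_succ,
          exists_exists_eq_and]
        exact or_congr eq_comm Iff.rfl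
      rw [blockCorrelation, apply_orderEmbOfFin (correlation ρ) _ hmono himg]
      congr 1
      funext j
      induction j using Fin.cases with
      | zero => simp [hf]
      | succ j => simp [hf]
    · have hcompl : Finset.univ \ insert 0 (D.map (Fin.succEmb n)) =
          Dᶜ.map (Fin.succOrderEmb n).toEmbedding := by
        ext i
        refine Fin.cases (by simp) (fun i => ?_) i
        simp [Fin.succ_ne_zero]
      rw [hcompl, ← partitionSum_blockCorrelation hpos, partitionSum_map]
      congr 1
      funext B
      rw [blockCorrelation_map]
      simp

end CorrelationRecursion

/-! ### Reweighted moments of isotropic processes -/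

section Reweighted

universe u

variable {M : Type u} {ρ : (n : ℕ) → (Fin n → S2 × M) → ℝ≥0}
  {E : Set M}

theorem rhoBar_nonneg : 0 ≤ rhoBar ρ E := Real.iInf_nonneg fun _ => NNReal.coe_nonneg _

theorem rhoBar_le {p : S2 × M} (hp : p.2 ∈ E) : rhoBar ρ E ≤ rho ρ p :=
  ciInf_le ⟨0, by rintro _ ⟨q, rfl⟩; exact NNReal.coe_nonneg _⟩
    (⟨p, hp⟩ : {p : S2 × M // p.2 ∈ E})

theorem uFun_nonneg (y : S2) (r : ℝ) (p : S2 × M) : 0 ≤ uFun ρ E y r p :=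
  Set.indicator_nonneg (fun _ _ => div_nonneg rhoBar_nonneg (NNReal.coe_nonneg _)) p

theorem uFun_le_one (y : S2) (r : ℝ) (p : S2 × M) : uFun ρ E y r p ≤ 1 :=
  Set.indicator_le' (fun _ hq => div_le_one_of_le₀ (rhoBar_le hq.2) (NNReal.coe_nonneg _))
    (fun _ _ => zero_le_one) p

theorem rhoRatio_nonneg (n : ℕ) (z : Fin n → S2 × M) : 0 ≤ rhoRatio ρ n z :=
  div_nonneg (NNReal.coe_nonneg _) (Finset.prod_nonneg fun _ _ => NNReal.coe_nonneg _)

theorem normRatio_nonneg (n : ℕ) (z : Fin n → S2 × M) : 0 ≤ normRatio ρ n z := by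
  unfold normRatio
  split_ifs
  · exact zero_le_one
  · exact rhoRatio_nonneg n z

variable [MeasurableSpace M]

theorem measurable_cons_pair (n : ℕ) :
    Measurable fun q : (S2 × M) × (Fin n → S2 × M) => (Fin.cons q.1 q.2 : Fin (n + 1) → S2 × M) :=
  measurable_pi_iff.2 (Fin.cases measurable_fst fun i => (measurable_pi_apply i).comp measurable_snd)

theorem measurable_uFun (hE : MeasurableSet E) (hρ : Measurable (rho ρ)) (y : S2) (r : ℝ) :
    Measurable (uFun ρ E y r) :=
  (measurable_const.div hρ.coe_nnreal_real).indicator ((measurableSet_geoBall y r).prod hE)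

variable [MetricSpace M] {Ω : Type*} [MeasurableSpace Ω] {P : Measure Ω} {X : Ω → Config (S2 × M)} {ν : Measure M}

theorem IsIRWMI.rho_ne_zero (h : IsIRWMI P X ν ρ) (p : S2 × M) : rho ρ p ≠ 0 := fun h0 => by
  have := h.rhoBar_pos.trans_le (rhoBar_le (ρ := ρ) (Set.mem_univ p.2))
  simp [h0] at this

theorem IsIRWMI.measurable_rho (h : IsIRWMI P X ν ρ) : Measurable (rho ρ) :=
  (h.intensity 1 le_rfl).1.comp (measurable_pi_iff.2 fun _ => measurable_id)

theorem IsIRWMI.measurable_rhoRatio (h : IsIRWMI P X ν ρ) {n : ℕ} (hn : 1 ≤ n) :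
    Measurable (rhoRatio ρ n) :=
  (h.intensity n hn).1.coe_nnreal_real.div (Finset.measurable_prod _ fun i _ =>
    (h.measurable_rho.comp (measurable_pi_apply i)).coe_nnreal_real)

theorem IsIRWMI.measurable_normRatio (h : IsIRWMI P X ν ρ) (n : ℕ) :
    Measurable (normRatio ρ n) := by
  unfold normRatio
  split_ifs with hn
  · exact measurable_const
  · exact h.measurable_rhoRatio (Nat.one_le_iff_ne_zero.2 hn)

/-- Every block factor in the partition sum is invariant; the intensities `ρ⁽ⁿ⁾` themselves need not
be. -/
theorem IsIRWMI.normRatio_rotate (h : IsIRWMI P X ν ρ) (n : ℕ) (O : Rot) (z : Fin n → S2 × M) :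
    normRatio ρ n (fun i => (rotate O (z i).1, (z i).2)) = normRatio ρ n z := by
  rw [← partitionSum_univ h.rho_ne_zero, ← partitionSum_univ h.rho_ne_zero]
  refine Finset.sum_congr rfl fun π _ => Finset.prod_congr rfl fun B hB => ?_
  exact h.isotropic B.card (π.nonempty_of_mem_parts hB).card_pos _ O

theorem IsIRWMI.rhoRatio_rotate (h : IsIRWMI P X ν ρ) {n : ℕ} (hn : 1 ≤ n) (O : Rot)
    (z : Fin n → S2 × M) :
    rhoRatio ρ n (fun i => (rotate O (z i).1, (z i).2)) = rhoRatio ρ n z := by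
  have := h.normRatio_rotate n O z
  rwa [normRatio, if_neg (by omega), normRatio, if_neg (by omega)] at this

/-- The measure `(λ ⊗ ν)ⁿ` on `(B(y, r) × E)ⁿ`. -/
noncomputable def windowMeasure (ν : Measure M) (E : Set M) (y : S2) (r : ℝ) (n : ℕ) :
    Measure (Fin n → S2 × M) :=
  Measure.pi fun _ : Fin n => (surf.prod ν).restrict (geoBall y r ×ˢ E)

instance [SigmaFinite ν] (y : S2) (r : ℝ) (n : ℕ) : SigmaFinite (windowMeasure ν E y r n) := by
  have : ∀ _ : Fin n, SigmaFinite ((surf.prod ν).restrict (geoBall y r ×ˢ E)) :=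
    fun _ => inferInstance
  unfold windowMeasure
  infer_instance

-- The factors `u` supply `ρ̄_E/ρ` at each coordinate and cut down to the window. The density `c`
-- stays general because both `ρ⁽ⁿ⁾` and the Palm density `ρ⁽ⁿ⁺¹⁾(p, ·)/ρ(p)` are inserted.
omit [MetricSpace M] in
theorem lintegral_prod_uFun [SigmaFinite ν] (hE : MeasurableSet E) (hρ : Measurable (rho ρ))
    (y : S2) (r : ℝ) {n : ℕ} {c : (Fin n → S2 × M) → ℝ≥0} (hc : Measurable c) :
    ∫⁻ z, (∏ i, ENNReal.ofReal (uFun ρ E y r (z i))) * c z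
        ∂(Measure.pi fun _ : Fin n => surf.prod ν) =
      ENNReal.ofReal (rhoBar ρ E ^ n) *
        ∫⁻ z, ENNReal.ofReal (c z / ∏ i, (rho ρ (z i) : ℝ)) ∂windowMeasure ν E y r n := by
  set W : Set (Fin n → S2 × M) := Set.univ.pi fun _ => geoBall y r ×ˢ E with hW
  have hWm : MeasurableSet W :=
    MeasurableSet.univ_pi fun _ => (measurableSet_geoBall y r).prod hE
  have hden : Measurable fun z : Fin n → S2 × M => ∏ i, (rho ρ (z i) : ℝ) :=
    Finset.measurable_prod _ fun i _ => (hρ.comp (measurable_pi_apply i)).coe_nnreal_real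
  have hmeas : Measurable fun z => ENNReal.ofReal ((c z : ℝ) / ∏ i, (rho ρ (z i) : ℝ)) :=
    (hc.coe_nnreal_real.div hden).ennreal_ofReal
  have hsf : ∀ _ : Fin n, SigmaFinite (surf.prod ν) := fun _ => inferInstance
  have hrestr : windowMeasure ν E y r n =
      (Measure.pi fun _ : Fin n => surf.prod ν).restrict W :=
    (@Measure.restrict_pi_pi _ _ _ _ _ hsf _).symm
  rw [hrestr, ← lintegral_const_mul _ hmeas, ← lintegral_indicator hWm]
  refine lintegral_congr fun z => ?_
  by_cases hz : z ∈ W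
  · rw [Set.indicator_of_mem hz, ← ENNReal.ofReal_prod_of_nonneg fun i _ => uFun_nonneg y r _,
      ← ENNReal.ofReal_coe_nnreal,
      ← ENNReal.ofReal_mul (Finset.prod_nonneg fun i _ => uFun_nonneg y r _),
      ← ENNReal.ofReal_mul (pow_nonneg rhoBar_nonneg _)]
    congr 1
    have : ∀ i, uFun ρ E y r (z i) = rhoBar ρ E / rho ρ (z i) := fun i =>
      Set.indicator_of_mem (hz i (Set.mem_univ i)) _
    simp_rw [this, Finset.prod_div_distrib, Finset.prod_const, Finset.card_univ, Fintype.card_fin]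
    ring
  · rw [Set.indicator_of_notMem hz]
    obtain ⟨i, hi⟩ : ∃ i, z i ∉ geoBall y r ×ˢ E := by
      by_contra! h
      exact hz fun i _ => h i
    have : uFun ρ E y r (z i) = 0 := Set.indicator_of_notMem hi _
    rw [Finset.prod_eq_zero (Finset.mem_univ i) (by rw [this, ENNReal.ofReal_zero]), zero_mul]

/-- The reweighted moments, with value `1` for `n = 0`. -/
noncomputable def normMoment (ν : Measure M) (ρ : (n : ℕ) → (Fin n → S2 × M) → ℝ≥0) (E : Set M)
    (r : ℝ) (n : ℕ) : ℝ≥0∞ :=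
  ∫⁻ z, ENNReal.ofReal (normRatio ρ n z) ∂windowMeasure ν E northPole r n

omit [MetricSpace M] in
theorem normMoment_eq_reweightedMoment {n : ℕ} (hn : n ≠ 0) (r : ℝ) :
    normMoment ν ρ E r n = reweightedMoment ν ρ E r n := by
  simp only [normMoment, normRatio, if_neg hn]
  rfl

omit [MetricSpace M] in
theorem normMoment_zero [SigmaFinite ν] (r : ℝ) : normMoment ν ρ E r 0 = 1 := by
  simp [normMoment, normRatio, windowMeasure]

omit [MetricSpace M] in
theorem measurePreserving_rotate_window [SigmaFinite ν] (hE : MeasurableSet E) {O : Rot} {y : S2}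
    (hO : rotate O northPole = y) (r : ℝ) (n : ℕ) :
    MeasurePreserving (fun (z : Fin n → S2 × M) i => (rotate O (z i).1, (z i).2))
      (windowMeasure ν E northPole r n) (windowMeasure ν E y r n) := by
  subst hO
  exact measurePreserving_rotate_tuple ν O northPole r hE n

theorem inv_factorial_mul_ofReal (b : ℝ) (n : ℕ) (c : ℝ≥0∞) :
    (n.factorial : ℝ≥0∞)⁻¹ * (ENNReal.ofReal (b ^ n) * c) =
      ENNReal.ofReal (b ^ n / n.factorial) * c := by
  rw [div_eq_inv_mul, ENNReal.ofReal_mul (by positivity), ENNReal.ofReal_inv_of_pos (by positivity),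
    ENNReal.ofReal_natCast, mul_assoc]

variable [SecondCountableTopology M] [BorelSpace M]

theorem IsIRWMI.expectedEsymm_uFun [IsProbabilityMeasure P] [SigmaFinite ν]
    (h : IsIRWMI P X ν ρ) (hX : Measurable X) (hE : MeasurableSet E) {O : Rot} {y : S2}
    (hO : rotate O northPole = y) (r : ℝ) (n : ℕ) :
    expectedEsymm P X (uFun ρ E y r) n =
      ENNReal.ofReal (rhoBar ρ E ^ n / n.factorial) * normMoment ν ρ E r n := by
  rcases Nat.eq_zero_or_pos n with rfl | hn
  · simp [expectedEsymm_zero, normMoment_zero]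
  have hu := measurable_uFun (ρ := ρ) hE h.measurable_rho y r
  have hprod : Measurable fun z : Fin n → S2 × M => ∏ i, ENNReal.ofReal (uFun ρ E y r (z i)) :=
    Finset.measurable_prod _ fun i _ => (hu.comp (measurable_pi_apply i)).ennreal_ofReal
  rw [expectedEsymm_eq hX hu, lintegral_distinctSum hX (h.intensity n hn) hprod,
    lintegral_prod_uFun hE h.measurable_rho y r (h.intensity n hn).1,
    inv_factorial_mul_ofReal _ n, normMoment_eq_reweightedMoment hn.ne']
  congr 1
  change ∫⁻ z, ENNReal.ofReal (rhoRatio ρ n z) ∂windowMeasure ν E y r n =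
    ∫⁻ z, ENNReal.ofReal (rhoRatio ρ n z) ∂windowMeasure ν E northPole r n
  rw [← (measurePreserving_rotate_window hE hO r n).lintegral_comp
    (h.measurable_rhoRatio hn).ennreal_ofReal]
  simp_rw [h.rhoRatio_rotate hn]

/-- The measure `ν(da) P^!_{(y, a)}(dx)` on `C × N`. -/
noncomputable def palmMeasure (ν : Measure M) (Q : Kernel (S2 × M) (Config (S2 × M))) (C : Set M)
    (y : S2) : Measure (M × Config (S2 × M)) :=
  (ν.restrict C) ⊗ₘ (Q.comap (fun a => (y, a)) measurable_prodMk_left)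

theorem IsIRWMI.ae_expectedEsymm_palm [SigmaFinite ν] (h : IsIRWMI P X ν ρ) (hX : Measurable X)
    {Q : Kernel (S2 × M) (Config (S2 × M))} (hQ : IsReducedPalm P X (surf.prod ν) ρ Q)
    {O : S2 → Rot} (hO : ∀ y, rotate (O y) northPole = y) (C : Set M) (hE : MeasurableSet E) :
    ∀ᵐ y ∂surf, ∀ (r : ℝ) (n : ℕ),
      expectedEsymm (palmMeasure ν Q C y) Prod.snd (uFun ρ E y r) n =
        ENNReal.ofReal (rhoBar ρ E ^ n / n.factorial) * crossMoment ν ρ C E r n := by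
  have := hQ.1
  have hae := ae_all_iff.2 fun n => ae_lintegral_reducedPalm_distinctSum hX h.measurable_rho
    h.rho_ne_zero hQ (h.intensity (n + 1) (by omega))
  -- The null set is fixed before `r` is chosen, as the Palm moment formula holds for all test
  -- functions; Fubini makes its mark sections null for almost every `y`.
  filter_upwards [Measure.ae_ae_of_ae_prod hae] with y hy r n
  have hu := measurable_uFun (ρ := ρ) hE h.measurable_rho y r
  have hprod : Measurable fun z : Fin n → S2 × M => ∏ i, ENNReal.ofReal (uFun ρ E y r (z i)) :=
    Finset.measurable_prod _ fun i _ => (hu.comp (measurable_pi_apply i)).ennreal_ofReal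
  have hcm : ∀ p : S2 × M, Measurable fun z : Fin n → S2 × M =>
      ρ (n + 1) (Fin.cons p z) / rho ρ p := fun p =>
    ((h.intensity (n + 1) (by omega)).1.comp
      ((measurable_cons_pair n).comp measurable_prodMk_left)).div_const _
  rw [expectedEsymm_eq measurable_snd hu, palmMeasure,
    Measure.lintegral_compProd (measurable_distinctSum_prod measurable_snd hu n),
    ← inv_factorial_mul_ofReal _ n]
  congr 1
  have hratio : ∀ (p : S2 × M) (z : Fin n → S2 × M),
      ((ρ (n + 1) (Fin.cons p z) / rho ρ p : ℝ≥0) : ℝ) / ∏ i, (rho ρ (z i) : ℝ) =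
        rhoRatio ρ (n + 1) (Fin.cons p z) := fun p z => by
    rw [rhoRatio, Fin.prod_univ_succ, Fin.cons_zero, NNReal.coe_div, div_div]
    simp
  have hinner : ∀ᵐ a ∂ν.restrict C, ∫⁻ x, distinctSum x n
        (fun z => ∏ i, ENNReal.ofReal (uFun ρ E y r (z i)))
        ∂(Q.comap (fun a => (y, a)) measurable_prodMk_left a) =
      ENNReal.ofReal (rhoBar ρ E ^ n) * ∫⁻ z, ENNReal.ofReal
        (rhoRatio ρ (n + 1) (Fin.cons (northPole, a) z)) ∂windowMeasure ν E northPole r n := by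
    filter_upwards [ae_restrict_of_ae hy] with a ha
    rw [Kernel.comap_apply, ha n _ hprod, lintegral_prod_uFun hE h.measurable_rho y r (hcm _)]
    simp_rw [hratio]
    congr 1
    have hm : Measurable fun z : Fin n → S2 × M =>
        ENNReal.ofReal (rhoRatio ρ (n + 1) (Fin.cons (y, a) z)) :=
      ((h.measurable_rhoRatio (by omega)).comp
        ((measurable_cons_pair n).comp measurable_prodMk_left)).ennreal_ofReal
    rw [← (measurePreserving_rotate_window hE (hO y) r n).lintegral_comp hm]
    refine lintegral_congr fun z => ?_
    rw [← h.rhoRatio_rotate (by omega) (O y) (Fin.cons (northPole, a) z)]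
    congr 2
    funext i
    induction i using Fin.cases with
    | zero => simp [hO]
    | succ i => simp
  have hjm : Measurable fun q : M × (Fin n → S2 × M) =>
      ENNReal.ofReal (rhoRatio ρ (n + 1) (Fin.cons (northPole, q.1) q.2)) :=
    ((h.measurable_rhoRatio (by omega)).comp ((measurable_cons_pair n).comp
      ((measurable_const.prodMk measurable_fst).prodMk measurable_snd))).ennreal_ofReal
  rw [lintegral_congr_ae hinner, lintegral_const_mul _ hjm.lintegral_prod_right', crossMoment]
  congr 1
  exact (lintegral_prod _ hjm.aemeasurable).symm

end Reweighted

/-! ### Root test and Cauchy products -/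

section Series

/-- The tail is dominated by a geometric series. The root test says nothing about the initial terms,
which `hb` makes finite by descent from the tail. -/
theorem tsum_ne_top_of_limsup_rpow_lt_one {b : ℕ → ℝ≥0∞}
    (hb : ∀ n, b (n + 1) ≠ ∞ → b n ≠ ∞)
    (h : limsup (fun n : ℕ => b n ^ (1 / (n : ℝ))) atTop < 1) : ∑' n, b n ≠ ∞ := by
  obtain ⟨c, hc, hc1⟩ := exists_between h
  obtain ⟨N, hN⟩ := eventually_atTop.1 (eventually_lt_of_limsup_lt hc)
  -- Starting at `N + 1` excludes `n = 0`, where the exponent `1 / 0` is `0` and the bound on the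
  -- root carries no information.
  have hle : ∀ n, N + 1 ≤ n → b n ≤ c ^ n := fun n hn => by
    have hn0 : (n : ℝ) ≠ 0 := Nat.cast_ne_zero.2 (by omega)
    have := ENNReal.rpow_le_rpow (hN n (by omega)).le (Nat.cast_nonneg (α := ℝ) n)
    rwa [← ENNReal.rpow_mul, one_div_mul_cancel hn0, ENNReal.rpow_one,
      ENNReal.rpow_natCast] at this
  have hctop : c ≠ ∞ := (hc1.trans ENNReal.one_lt_top).ne
  have htop : ∀ k n, n + k = N + 1 → b n ≠ ∞ := by
    intro k
    induction k with
    | zero =>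
      intro n hn
      exact ne_top_of_le_ne_top (ENNReal.pow_ne_top hctop) (hle n (by omega))
    | succ k ih => exact fun n hn => hb n (ih (n + 1) (by omega))
  have hbound : ∀ n, b n ≤ (if n < N + 1 then b n else 0) + c ^ n := fun n => by
    split_ifs with hn
    · exact le_self_add
    · simpa using hle n (by omega)
  refine ne_top_of_le_ne_top ?_ (ENNReal.tsum_le_tsum hbound)
  rw [ENNReal.tsum_add, ENNReal.tsum_geometric, tsum_eq_sum (s := Finset.range (N + 1))
    fun n hn => if_neg (by simpa using hn)]
  refine ENNReal.add_ne_top.2 ⟨ENNReal.sum_ne_top.2 fun n hn => ?_, ENNReal.inv_ne_top.2 ?_⟩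
  · have := Finset.mem_range.1 hn
    rw [if_pos this]
    exact htop (N + 1 - n) n (by omega)
  · exact (tsub_pos_of_lt hc1).ne'

/-- A Cauchy product of a convergent and an absolutely convergent series, inside the unit disc. -/
theorem summable_cauchyProduct_mul_pow {a g c : ℕ → ℝ} {l : ℝ}
    (ha : Tendsto (fun n => ∑ i ∈ Finset.range n, a i) atTop (𝓝 l))
    (hg : Summable fun n => ‖g n‖)
    (hc : ∀ n, c n = ∑ q ∈ Finset.HasAntidiagonal.antidiagonal n, a q.1 * g q.2) {s : ℝ}
    (hs : s ∈ Set.Ioo (0 : ℝ) 1) :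
    (Summable fun n => ‖c n * s ^ n‖) ∧
      ∑' n, c n * s ^ n = (∑' n, a n * s ^ n) * ∑' n, g n * s ^ n := by
  -- The series of `a` may converge only conditionally, but its power series converges absolutely
  -- inside the unit disc.
  have ha' : Summable fun n => ‖a n * s ^ n‖ := by
    refine Summable.norm ?_
    refine summable_powerSeries_of_norm_lt_one ha.cauchySeq ?_
    rw [Real.norm_of_nonneg hs.1.le]
    exact hs.2
  have hg' : Summable fun n => ‖g n * s ^ n‖ := by
    refine Summable.of_nonneg_of_le (fun n => norm_nonneg _) (fun n => ?_) hg
    rw [norm_mul, norm_pow, Real.norm_of_nonneg hs.1.le]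
    exact mul_le_of_le_one_right (norm_nonneg _) (pow_le_one₀ hs.1.le hs.2.le)
  have hterm : ∀ n, c n * s ^ n =
      ∑ q ∈ Finset.HasAntidiagonal.antidiagonal n, (a q.1 * s ^ q.1) * (g q.2 * s ^ q.2) := fun n => by
    rw [hc, Finset.sum_mul]
    refine Finset.sum_congr rfl fun q hq => ?_
    rw [← Finset.HasAntidiagonal.mem_antidiagonal.1 hq, pow_add]
    ring
  have hfun : (fun n => c n * s ^ n) = fun n => ∑ q ∈ Finset.HasAntidiagonal.antidiagonal n,
      (a q.1 * s ^ q.1) * (g q.2 * s ^ q.2) := funext hterm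
  have h1 := summable_norm_sum_mul_antidiagonal_of_summable_norm
    (f := fun n => a n * s ^ n) (g := fun n => g n * s ^ n) ha' hg'
  have h2 := tsum_mul_tsum_eq_tsum_sum_antidiagonal_of_summable_norm
    (f := fun n => a n * s ^ n) (g := fun n => g n * s ^ n) ha' hg'
  refine ⟨h1.congr fun n => by rw [hterm n], ?_⟩
  rw [hfun, h2]

theorem neg_pow_div_factorial_mul_sum (b : ℝ) (j g : ℕ → ℝ) (n : ℕ) :
    (-b) ^ n / n.factorial * ∑ k ∈ Finset.range (n + 1), (n.choose k : ℝ) * (j k * g (n - k)) =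
      ∑ q ∈ Finset.HasAntidiagonal.antidiagonal n,
        ((-b) ^ q.1 / q.1.factorial * j q.1) * ((-b) ^ q.2 / q.2.factorial * g q.2) := by
  rw [Finset.Nat.sum_antidiagonal_eq_sum_range_succ fun k m =>
    ((-b) ^ k / k.factorial * j k) * ((-b) ^ m / m.factorial * g m), Finset.mul_sum]
  refine Finset.sum_congr rfl fun k hk => ?_
  have hkn : k ≤ n := Nat.lt_succ_iff.1 (Finset.mem_range.1 hk)
  rw [Nat.cast_choose ℝ hkn]
  have h1 : (n.factorial : ℝ) ≠ 0 := Nat.cast_ne_zero.2 n.factorial_ne_zero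
  have hp : (-b) ^ n = (-b) ^ k * (-b) ^ (n - k) := by rw [← pow_add, Nat.add_sub_cancel' hkn]
  rw [hp]
  field_simp

end Series

/-! ### Cross moments in terms of the integrals `J_n` -/

section CrossMoments

theorem measurePreserving_pi_split {Z : Type*} [MeasurableSpace Z] (m : Measure Z) [SigmaFinite m]
    {n : ℕ} (D : Finset (Fin n)) :
    MeasurePreserving (fun z : Fin n → Z =>
        ((fun j => z (D.orderEmbOfFin rfl j) : Fin D.card → Z),
          (fun j => z (Dᶜ.orderEmbOfFin rfl j) : Fin Dᶜ.card → Z)))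
      (Measure.pi fun _ => m) ((Measure.pi fun _ => m).prod (Measure.pi fun _ => m)) := by
  have h1 := (measurePreserving_piCongrLeft (fun _ : Fin n => m)
    (finSumEquivOfFinset (s := D) rfl rfl)).symm
  have h2 := measurePreserving_sumPiEquivProdPi (fun _ : Fin D.card ⊕ Fin Dᶜ.card => m)
  exact h2.comp h1

universe u

variable {M : Type u} [MetricSpace M] [MeasurableSpace M] {ρ : (n : ℕ) → (Fin n → S2 × M) → ℝ≥0}
  {C E : Set M} {Ω : Type*} [MeasurableSpace Ω] {P : Measure Ω} {X : Ω → Config (S2 × M)}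
  {ν : Measure M} {O : S2 → Rot}

theorem IsIRWMI.jIntegrand_eq (h : IsIRWMI P X ν ρ) (hO : ∀ y, rotate (O y) northPole = y)
    (y : S2) (n : ℕ) (q : M × (Fin n → S2 × M)) :
    jIntegrand ρ O y n q = correlation ρ (n + 1) (Fin.cons (northPole, q.1) q.2) := by
  rw [← h.isotropic (n + 1) (by omega) (Fin.cons (northPole, q.1) q.2) (O y), jIntegrand]
  congr 1
  funext i
  induction i using Fin.cases with
  | zero => simp [hO]
  | succ i => simp

theorem IsIRWMI.jIntegrand_congr (h : IsIRWMI P X ν ρ) (hO : ∀ y, rotate (O y) northPole = y)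
    (y y' : S2) : jIntegrand ρ O y = jIntegrand ρ O y' := by
  funext n q
  rw [h.jIntegrand_eq hO, h.jIntegrand_eq hO]

omit [MetricSpace M] [MeasurableSpace M] in
theorem jIntegrand_zero (y : S2) : jIntegrand ρ O y 0 = fun _ => 1 :=
  funext fun _ => correlation_one ρ _

omit [MetricSpace M] in
theorem jMeasure_zero [SigmaFinite ν] (r : ℝ) :
    jMeasure ν C E r 0 Set.univ = ν C := by
  rw [jMeasure, ← Set.univ_prod_univ, Measure.prod_prod]
  simp

-- Since `ξ₁ = 1`, the summand `ν(C)` in `J` is the term `n = 0` of its series.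
omit [MetricSpace M] in
theorem Jn_zero [SigmaFinite ν] (y : S2) (r : ℝ) : Jn ν ρ O C E y r 0 = ν.real C := by
  rw [Jn, jIntegrand_zero, integral_const, smul_eq_mul, mul_one, Measure.real, jMeasure_zero,
    Measure.real]

/-- Each summand of the block recursion factorizes over the coordinates in `D` and `Dᶜ`, so its
integral depends only on the size of `D`; counting subsets gives the binomial coefficient.
Finiteness follows because each of the finitely many summands is integrable. -/
theorem IsIRWMI.crossMoment_eq [SigmaFinite ν] (h : IsIRWMI P X ν ρ)
    (hO : ∀ y, rotate (O y) northPole = y) (hC : ν C ≠ ∞) {y : S2} {r : ℝ}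
    (hJ : ∀ n, 1 ≤ n → Integrable (jIntegrand ρ O y n) (jMeasure ν C E r n))
    (hG : ∀ n, normMoment ν ρ E r n ≠ ∞) (n : ℕ) :
    crossMoment ν ρ C E r n ≠ ∞ ∧ (crossMoment ν ρ C E r n).toReal =
      ∑ k ∈ Finset.range (n + 1),
        (n.choose k : ℝ) * (Jn ν ρ O C E y r k * (normMoment ν ρ E r (n - k)).toReal) := by
  have hJ' : ∀ n, Integrable (jIntegrand ρ O y n) (jMeasure ν C E r n) := fun n => by
    rcases Nat.eq_zero_or_pos n with rfl | hn
    · rw [jIntegrand_zero]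
      have : IsFiniteMeasure (jMeasure ν C E r 0) := ⟨by
        rw [jMeasure_zero]
        exact hC.lt_top⟩
      exact integrable_const _
    · exact hJ n hn
  have hGm : ∀ n, Integrable (normRatio ρ n) (windowMeasure ν E northPole r n) := fun n => by
    refine ⟨(h.measurable_normRatio n).aestronglyMeasurable, ?_⟩
    rw [hasFiniteIntegral_iff_ofReal (Eventually.of_forall fun z => normRatio_nonneg n z)]
    exact (hG n).lt_top
  have hGi : ∀ n, ∫ z, normRatio ρ n z ∂windowMeasure ν E northPole r n =
      (normMoment ν ρ E r n).toReal := fun n =>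
    integral_eq_lintegral_of_nonneg_ae (Eventually.of_forall fun z => normRatio_nonneg n z)
      (h.measurable_normRatio n).aestronglyMeasurable
  have hsplit : ∀ D : Finset (Fin n), MeasurePreserving
      (fun q : M × (Fin n → S2 × M) => (((q.1, fun j => q.2 (D.orderEmbOfFin rfl j)) :
        M × (Fin D.card → S2 × M)), (fun j => q.2 (Dᶜ.orderEmbOfFin rfl j) :
          Fin Dᶜ.card → S2 × M)))
      (jMeasure ν C E r n)
      ((jMeasure ν C E r D.card).prod (windowMeasure ν E northPole r Dᶜ.card)) := fun D => by
    have h0 : MeasurePreserving _ (windowMeasure ν E northPole r n)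
        ((windowMeasure ν E northPole r D.card).prod (windowMeasure ν E northPole r Dᶜ.card)) :=
      measurePreserving_pi_split ((surf.prod ν).restrict (geoBall northPole r ×ˢ E)) D
    have h1 := (MeasurePreserving.id (ν.restrict C)).prod h0
    exact ((measurePreserving_prodAssoc (ν.restrict C) (windowMeasure ν E northPole r D.card)
      (windowMeasure ν E northPole r Dᶜ.card)).symm).comp h1
  set φ : (D : Finset (Fin n)) →
      (M × (Fin D.card → S2 × M)) × (Fin Dᶜ.card → S2 × M) → ℝ := fun D q =>
    jIntegrand ρ O y D.card q.1 * normRatio ρ Dᶜ.card q.2 with hφ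
  have hφi : ∀ D, Integrable (φ D)
      ((jMeasure ν C E r D.card).prod (windowMeasure ν E northPole r Dᶜ.card)) := fun D => by
    have : SigmaFinite (jMeasure ν C E r D.card) :=
      inferInstanceAs (SigmaFinite ((ν.restrict C).prod (windowMeasure ν E northPole r D.card)))
    exact (hJ' D.card).mul_prod (hGm Dᶜ.card)
  have hint : ∀ D, Integrable (fun q : M × (Fin n → S2 × M) =>
      φ D ((q.1, fun j => q.2 (D.orderEmbOfFin rfl j)), fun j => q.2 (Dᶜ.orderEmbOfFin rfl j)))
      (jMeasure ν C E r n) := fun D =>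
    ((hsplit D).integrable_comp (hφi D).aestronglyMeasurable).2 (hφi D)
  have hval : ∀ D : Finset (Fin n), ∫ q, φ D ((q.1, fun j => q.2 (D.orderEmbOfFin rfl j)),
        fun j => q.2 (Dᶜ.orderEmbOfFin rfl j)) ∂jMeasure ν C E r n =
      Jn ν ρ O C E y r D.card * (normMoment ν ρ E r (n - D.card)).toReal := fun D => by
    have hm := integral_map (hsplit D).aemeasurable
      (by rw [(hsplit D).map_eq]; exact (hφi D).aestronglyMeasurable)
    have : SigmaFinite (jMeasure ν C E r D.card) :=
      inferInstanceAs (SigmaFinite ((ν.restrict C).prod (windowMeasure ν E northPole r D.card)))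
    rw [← hm, (hsplit D).map_eq, hφ, integral_prod_mul, hGi, Finset.card_compl, Fintype.card_fin]
    rfl
  have hsum : ∀ q : M × (Fin n → S2 × M),
      rhoRatio ρ (n + 1) (Fin.cons (northPole, q.1) q.2) =
        ∑ D : Finset (Fin n), φ D ((q.1, fun j => q.2 (D.orderEmbOfFin rfl j)),
          fun j => q.2 (Dᶜ.orderEmbOfFin rfl j)) := fun q => by
    rw [rhoRatio_cons_eq_sum h.rho_ne_zero]
    refine Finset.sum_congr rfl fun D _ => ?_
    simp only [hφ, h.jIntegrand_eq hO]
  have hI : Integrable (fun q : M × (Fin n → S2 × M) =>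
      rhoRatio ρ (n + 1) (Fin.cons (northPole, q.1) q.2)) (jMeasure ν C E r n) := by
    simp_rw [hsum]
    exact integrable_finsetSum _ fun D _ => hint D
  have hcross : crossMoment ν ρ C E r n = ENNReal.ofReal
      (∫ q, rhoRatio ρ (n + 1) (Fin.cons (northPole, q.1) q.2) ∂jMeasure ν C E r n) :=
    (ofReal_integral_eq_lintegral_ofReal hI
      (Eventually.of_forall fun q => rhoRatio_nonneg _ _)).symm
  refine ⟨hcross ▸ ENNReal.ofReal_ne_top, ?_⟩
  rw [hcross, ENNReal.toReal_ofReal (integral_nonneg fun q => rhoRatio_nonneg _ _)]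
  simp_rw [hsum]
  rw [integral_finsetSum _ fun D _ => hint D, Finset.sum_congr rfl fun D _ => hval D]
  have := Finset.sum_powerset_apply_card (x := (Finset.univ : Finset (Fin n)))
    fun k => Jn ν ρ O C E y r k * (normMoment ν ρ E r (n - k)).toReal
  simpa [nsmul_eq_mul] using this

theorem IsIRWMI.crossMoment_zero [SigmaFinite ν] (h : IsIRWMI P X ν ρ) (r : ℝ) :
    crossMoment ν ρ C E r 0 = ν C := by
  simp only [crossMoment, rhoRatio_one h.rho_ne_zero, ENNReal.ofReal_one,
    lintegral_const, one_mul, jMeasure_zero]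

end CrossMoments

/-! ### The summary statistics as Abel sums -/

section SummaryStatistics

universe u

variable {M : Type u} [MetricSpace M] [MeasurableSpace M]
  {ρ : (n : ℕ) → (Fin n → S2 × M) → ℝ≥0}
  {C E : Set M} {Ω : Type*} [MeasurableSpace Ω] {P : Measure Ω} {X : Ω → Config (S2 × M)}
  {ν : Measure M} {O : S2 → Rot} {r : ℝ}

/-- The coefficients `ρ̄_Eⁿ / n! · ∫ ρ⁽ⁿ⁾ / (ρ ⋯ ρ)` of the series for `1 - F`. -/
noncomputable def momentCoeff (ν : Measure M) (ρ : (n : ℕ) → (Fin n → S2 × M) → ℝ≥0) (E : Set M)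
    (r : ℝ) (n : ℕ) : ℝ≥0∞ :=
  ENNReal.ofReal (rhoBar ρ E ^ n / n.factorial) * normMoment ν ρ E r n

/-- The coefficients `ρ̄_Eⁿ / n! · ∫ ρ⁽ⁿ⁺¹⁾ / (ρ ⋯ ρ)` of the series for `1 - D`. -/
noncomputable def crossCoeff (ν : Measure M) (ρ : (n : ℕ) → (Fin n → S2 × M) → ℝ≥0)
    (C E : Set M) (r : ℝ) (n : ℕ) : ℝ≥0∞ :=
  ENNReal.ofReal (rhoBar ρ E ^ n / n.factorial) * crossMoment ν ρ C E r n

omit [MetricSpace M] [MeasurableSpace M] in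
theorem rhoBar_pow_div_nonneg (n : ℕ) : 0 ≤ rhoBar ρ E ^ n / n.factorial :=
  div_nonneg (pow_nonneg rhoBar_nonneg n) (Nat.cast_nonneg _)

omit [MetricSpace M] in
theorem toReal_momentCoeff (n : ℕ) : (momentCoeff ν ρ E r n).toReal =
    rhoBar ρ E ^ n / n.factorial * (normMoment ν ρ E r n).toReal := by
  rw [momentCoeff, ENNReal.toReal_mul, ENNReal.toReal_ofReal (rhoBar_pow_div_nonneg n)]

omit [MetricSpace M] in
theorem toReal_crossCoeff (n : ℕ) : (crossCoeff ν ρ C E r n).toReal =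
    rhoBar ρ E ^ n / n.factorial * (crossMoment ν ρ C E r n).toReal := by
  rw [crossCoeff, ENNReal.toReal_mul, ENNReal.toReal_ofReal (rhoBar_pow_div_nonneg n)]

theorem tsum_ofReal_pow_mul_ne_top {b : ℕ → ℝ≥0∞} (hb : ∑' n, b n ≠ ∞) {s : ℝ}
    (hs : s ∈ Set.Ioo (0 : ℝ) 1) : ∑' n, ENNReal.ofReal (s ^ n) * b n ≠ ∞ := by
  refine ne_top_of_le_ne_top hb (ENNReal.tsum_le_tsum fun n => ?_)
  exact mul_le_of_le_one_left' (ENNReal.ofReal_le_one.2 (pow_le_one₀ hs.1.le hs.2.le))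

variable [SecondCountableTopology M] [BorelSpace M] [SigmaFinite ν]

theorem IsIRWMI.tsum_momentCoeff_ne_top [IsProbabilityMeasure P] (h : IsIRWMI P X ν ρ)
    (hX : Measurable X) (hE : MeasurableSet E) (hO : ∀ y, rotate (O y) northPole = y)
    (hR : RootCondition ν ρ E r) : ∑' n, momentCoeff ν ρ E r n ≠ ∞ := by
  refine tsum_ne_top_of_limsup_rpow_lt_one (fun n => ?_) ?_
  · have he := h.expectedEsymm_uFun hX hE (hO northPole) r
    rw [momentCoeff, momentCoeff, ← he, ← he]
    exact expectedEsymm_ne_top_of_succ hX (measurable_uFun hE h.measurable_rho _ _)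
      (uFun_le_one _ _)
  -- The two versions of the moments may differ at `n = 0`, which the limsup ignores.
  · refine lt_of_eq_of_lt (limsup_congr ?_) hR
    filter_upwards [eventually_ne_atTop 0] with n hn
    rw [momentCoeff, normMoment_eq_reweightedMoment hn]

theorem IsIRWMI.tendsto_momentSeries [IsProbabilityMeasure P] (h : IsIRWMI P X ν ρ)
    (hX : Measurable X) (hE : MeasurableSet E) (hO : ∀ y, rotate (O y) northPole = y)
    (hR : RootCondition ν ρ E r) (y : S2) :
    Tendsto (fun s : ℝ => ∑' n, (-s) ^ n * (momentCoeff ν ρ E r n).toReal) (𝓝[<] 1)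
      (𝓝 (1 - FInhom P X ρ E y r)) := by
  have he : expectedEsymm P X (uFun ρ E y r) = momentCoeff ν ρ E r :=
    funext (h.expectedEsymm_uFun hX hE (hO y) r)
  have ht := (tendsto_tsum_expectedEsymm (μ := P) hX (measurable_uFun hE h.measurable_rho y r)
    (uFun_nonneg y r) (uFun_le_one y r) fun s hs => by
      rw [he]
      exact tsum_ofReal_pow_mul_ne_top (h.tsum_momentCoeff_ne_top hX hE hO hR) hs).2
  rw [he] at ht
  rwa [FInhom, sub_sub_cancel]

theorem tendsto_crossSeries (hE : MeasurableSet E) (hρ : Measurable (rho ρ)) (hC : ν C ≠ ∞)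
    {Q : Kernel (S2 × M) (Config (S2 × M))} [IsMarkovKernel Q] {y : S2}
    (hy : ∀ n, expectedEsymm (palmMeasure ν Q C y) Prod.snd (uFun ρ E y r) n =
      crossCoeff ν ρ C E r n)
    (hfin : ∀ s ∈ Set.Ioo (0 : ℝ) 1,
      ∑' n, ENNReal.ofReal (s ^ n) * crossCoeff ν ρ C E r n ≠ ∞) :
    Tendsto (fun s : ℝ => ∑' n, (-s) ^ n * (crossCoeff ν ρ C E r n).toReal) (𝓝[<] 1)
      (𝓝 (∫ a in C, (∫ x, pointProd x (fun p => 1 - uFun ρ E y r p) ∂(Q (y, a))) ∂ν)) := by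
  have : IsFiniteMeasure (ν.restrict C) := ⟨by
    rw [Measure.restrict_apply_univ]
    exact hC.lt_top⟩
  have : IsFiniteMeasure (palmMeasure ν Q C y) := by
    unfold palmMeasure
    infer_instance
  have he : expectedEsymm (palmMeasure ν Q C y) Prod.snd (uFun ρ E y r) =
      crossCoeff ν ρ C E r := funext hy
  obtain ⟨hi, ht⟩ := tendsto_tsum_expectedEsymm (μ := palmMeasure ν Q C y) measurable_snd
    (measurable_uFun hE hρ y r) (uFun_nonneg y r) (uFun_le_one y r) (by rwa [he])
  rw [he] at ht
  rw [palmMeasure] at hi ht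
  -- Integrability on the joint space of marks and configurations splits the integral into the
  -- iterated one that defines `D`.
  rw [Measure.integral_compProd hi] at ht
  simpa only [Kernel.comap_apply] using ht

-- `CrossSeriesFinite` starts at order `1`; the missing term of order `0` is `ν(C)`.
omit [SecondCountableTopology M] [BorelSpace M] in
theorem IsIRWMI.tsum_crossCoeff_ne_top (h : IsIRWMI P X ν ρ) (hC : ν C ≠ ∞)
    (hfin : CrossSeriesFinite ν ρ C E r) : ∑' n, crossCoeff ν ρ C E r n ≠ ∞ := by
  rw [tsum_eq_zero_add' ENNReal.summable]
  refine ENNReal.add_ne_top.2 ⟨?_, hfin.ne⟩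
  simpa [crossCoeff, h.crossMoment_zero] using hC

omit [MetricSpace M] [SecondCountableTopology M] [BorelSpace M] in
theorem tendsto_sum_jSeries {y : S2} {l : ℝ}
    (hl : Tendsto (jPartialSum ν ρ O C E y r) atTop (𝓝 l)) :
    Tendsto (fun k => ∑ n ∈ Finset.range k,
      (-rhoBar ρ E) ^ n / (n.factorial : ℝ) * Jn ν ρ O C E y r n) atTop (𝓝 (ν.real C + l)) := by
  -- `jPartialSum` at `k` runs over `1, …, k`, which is `Finset.range (k + 1)` without its term of
  -- order `0`.
  rw [← tendsto_add_atTop_iff_nat 1]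
  refine (tendsto_const_nhds.add hl).congr fun k => ?_
  rw [Finset.sum_range_eq_add_Ico _ (Nat.succ_pos k), Jn_zero, jPartialSum]
  simp only [pow_zero, Nat.factorial_zero, Nat.cast_one, div_one, one_mul]
  rfl

omit [SecondCountableTopology M] [BorelSpace M] [SigmaFinite ν] in
theorem IsIRWMI.rhoBar_pos_of_nonempty (h : IsIRWMI P X ν ρ) (hE : E.Nonempty) :
    0 < rhoBar ρ E := by
  obtain ⟨m, hm⟩ := hE
  have : Nonempty {p : S2 × M // p.2 ∈ E} := ⟨⟨(northPole, m), hm⟩⟩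
  exact h.rhoBar_pos.trans_le (le_ciInf fun p => rhoBar_le (Set.mem_univ _))

-- The factor `ρ̄_Eⁿ/n!` can be cancelled when `E` is nonempty. For empty `E` the infimum has the
-- default value `0`, but then the window is empty and the moments of positive order vanish.
omit [SecondCountableTopology M] [BorelSpace M] in
theorem IsIRWMI.normMoment_ne_top (h : IsIRWMI P X ν ρ) {n : ℕ}
    (hn : momentCoeff ν ρ E r n ≠ ∞) : normMoment ν ρ E r n ≠ ∞ := by
  rcases E.eq_empty_or_nonempty with rfl | hE
  · rcases Nat.eq_zero_or_pos n with rfl | hpos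
    · simp [normMoment_zero]
    · have hsf : ∀ _ : Fin n, SigmaFinite ((surf.prod ν).restrict
          (geoBall northPole r ×ˢ (∅ : Set M))) := fun _ => inferInstance
      have h0 : windowMeasure ν (∅ : Set M) northPole r n = 0 := by
        rw [← Measure.measure_univ_eq_zero, windowMeasure, @Measure.pi_univ _ _ _ _ _ hsf]
        exact Finset.prod_eq_zero (Finset.mem_univ ⟨0, hpos⟩) (by simp)
      simp [normMoment, h0]
  · intro htop
    refine hn ?_
    rw [momentCoeff, htop, ENNReal.mul_top]
    have := h.rhoBar_pos_of_nonempty hE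
    simpa using (by positivity : 0 < rhoBar ρ E ^ n / n.factorial)

/-- The series for `1 - D` is, up to normalization, the Cauchy product of the series for `J` and
for `1 - F`. -/
theorem IsIRWMI.crossSeries_eq_mul [IsProbabilityMeasure P] (h : IsIRWMI P X ν ρ)
    (hX : Measurable X) (hE : MeasurableSet E) (hO : ∀ y, rotate (O y) northPole = y)
    (hC : ν C ≠ ∞) (hR : RootCondition ν ρ E r) {y : S2} (hJ : JDefined ν ρ O C E y r) :
    (∀ s ∈ Set.Ioo (0 : ℝ) 1, ∑' n, ENNReal.ofReal (s ^ n) * crossCoeff ν ρ C E r n ≠ ∞) ∧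
      Tendsto (fun s : ℝ => ∑' n, (-s) ^ n * (crossCoeff ν ρ C E r n).toReal) (𝓝[<] 1)
        (𝓝 ((ν.real C + limUnder atTop (jPartialSum ν ρ O C E y r)) *
          (1 - FInhom P X ρ E northPole r))) := by
  obtain ⟨hJi, l, hl⟩ := hJ
  have hB := h.tsum_momentCoeff_ne_top hX hE hO hR
  have hG : ∀ n, normMoment ν ρ E r n ≠ ∞ := fun n =>
    h.normMoment_ne_top (ENNReal.ne_top_of_tsum_ne_top hB n)
  have hcross := h.crossMoment_eq hO hC hJi hG
  set b := rhoBar ρ E with hb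
  set g : ℕ → ℝ := fun n => (-b) ^ n / (n.factorial : ℝ) * (normMoment ν ρ E r n).toReal with hg
  set c : ℕ → ℝ := fun n => (-b) ^ n / (n.factorial : ℝ) * (crossMoment ν ρ C E r n).toReal
    with hc
  have ha := tendsto_sum_jSeries hl
  have hneg : ∀ n, (-b) ^ n = (-1) ^ n * b ^ n := fun n => by rw [← mul_pow, neg_one_mul]
  have hgs : Summable fun n => ‖g n‖ := by
    refine (ENNReal.summable_toReal hB).congr fun n => ?_
    rw [toReal_momentCoeff, hg, norm_mul, norm_div, norm_pow, norm_neg,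
      Real.norm_of_nonneg rhoBar_nonneg, Real.norm_natCast,
      Real.norm_of_nonneg ENNReal.toReal_nonneg]
  have hca : ∀ n, c n = ∑ q ∈ Finset.HasAntidiagonal.antidiagonal n,
      ((-b) ^ q.1 / (q.1.factorial : ℝ) * Jn ν ρ O C E y r q.1) * g q.2 := fun n => by
    rw [hc, ← neg_pow_div_factorial_mul_sum b (Jn ν ρ O C E y r)
      fun n => (normMoment ν ρ E r n).toReal, ← (hcross n).2]
  have hprod := fun s (hs : s ∈ Set.Ioo (0 : ℝ) 1) => summable_cauchyProduct_mul_pow ha hgs hca hs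
  have hK : ∀ n, crossCoeff ν ρ C E r n ≠ ∞ := fun n =>
    ENNReal.mul_ne_top ENNReal.ofReal_ne_top (hcross n).1
  have hcs : ∀ (s : ℝ) n, (-s) ^ n * (crossCoeff ν ρ C E r n).toReal = c n * s ^ n := fun s n => by
    rw [toReal_crossCoeff, hc, ← neg_one_mul s, mul_pow]
    simp only [hneg]
    ring
  have hgsn : ∀ (s : ℝ) n, (-s) ^ n * (momentCoeff ν ρ E r n).toReal = g n * s ^ n := fun s n => by
    rw [toReal_momentCoeff, hg, ← neg_one_mul s, mul_pow]
    simp only [hneg]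
    ring
  refine ⟨fun s hs => ?_, ?_⟩
  · have hterm : ∀ n, ENNReal.ofReal (s ^ n) * crossCoeff ν ρ C E r n =
        ENNReal.ofReal ‖c n * s ^ n‖ := fun n => by
      rw [← hcs, norm_mul, norm_pow, norm_neg, Real.norm_of_nonneg hs.1.le,
        Real.norm_of_nonneg ENNReal.toReal_nonneg, ENNReal.ofReal_mul (pow_nonneg hs.1.le n),
        ENNReal.ofReal_toReal (hK n)]
    simp_rw [hterm]
    exact (hprod s hs).1.tsum_ofReal_ne_top
  · have hF := h.tendsto_momentSeries hX hE hO hR northPole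
    simp_rw [hgsn] at hF
    simp_rw [hcs]
    rw [hl.limUnder_eq]
    -- Abel's theorem gives the limit of the `J` factor and the expected product that of the other;
    -- the product identity itself is used only for `s < 1`.
    refine ((Real.tendsto_tsum_powerSeries_nhdsWithin_lt ha).mul hF).congr' ?_
    filter_upwards [Ioo_mem_nhdsLT (one_pos (α := ℝ))] with s hs
    exact (hprod s hs).2.symm

end SummaryStatistics

end SphericalPP

/-! ### The main theorem -/

theorem mainTheorem1 {M : Type*} [MetricSpace M] [CompleteSpace M] [SecondCountableTopology M]
    [MeasurableSpace M] [BorelSpace M] (ν : Measure M) [SigmaFinite ν]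
    {Ω : Type*} [MeasurableSpace Ω] (P : Measure Ω) [IsProbabilityMeasure P]
    (X : Ω → Config (S2 × M)) (hX : Measurable X)
    (ρ : (n : ℕ) → (Fin n → S2 × M) → ℝ≥0) (hIRWMI : IsIRWMI P X ν ρ)
    (Q : Kernel (S2 × M) (Config (S2 × M))) (hQ : IsReducedPalm P X (surf.prod ν) ρ Q)
    (O : S2 → Rot) (hO : ∀ y, rotate (O y) northPole = y)
    (C E : Set M) (hC : MeasurableSet C) (hE : MeasurableSet E)
    (hC_pos : ν C ≠ 0) (hC_fin : ν C ≠ ∞) :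
    ∃ F D J : ℝ → ℝ,
      (∀ r ∈ Set.Icc 0 Real.pi, RootCondition ν ρ E r → ∀ y, FInhom P X ρ E y r = F r) ∧
      (∀ r ∈ Set.Icc 0 Real.pi, (∃ y, JDefined ν ρ O C E y r) →
        ∀ y, JDefined ν ρ O C E y r ∧ JInhom ν ρ O C E y r = J r) ∧
      (∀ᵐ y ∂surf, ∀ r ∈ Set.Icc 0 Real.pi, RootCondition ν ρ E r →
        ((∃ y', JDefined ν ρ O C E y' r) ∨ CrossSeriesFinite ν ρ C E r) →
          DInhom ν Q ρ C E y r = D r) ∧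
      (∀ r ∈ Set.Icc 0 Real.pi, RootCondition ν ρ E r → (∃ y, JDefined ν ρ O C E y r) →
        F r ≠ 1 → J r = (1 - D r) / (1 - F r)) := by
  have hJn : ∀ y y', Jn ν ρ O C E y = Jn ν ρ O C E y' := fun y y' => by
    unfold Jn
    rw [hIRWMI.jIntegrand_congr hO y y']
  have hJs : ∀ y y', jPartialSum ν ρ O C E y = jPartialSum ν ρ O C E y' := fun y y' => by
    unfold jPartialSum
    rw [hJn y y']
  have hJd : ∀ y y' r, JDefined ν ρ O C E y r → JDefined ν ρ O C E y' r := fun y y' r h => by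
    unfold JDefined at h ⊢
    rwa [hJs y' y, hIRWMI.jIntegrand_congr hO y' y]
  have := hQ.1
  -- `D` is defined by the Abel limit of the cross series, which involves neither `y` nor `Q`. Where
  -- that limit fails to exist, `limUnder` has a default value about which nothing is claimed.
  refine ⟨FInhom P X ρ E northPole, fun r => 1 - (ν.real C)⁻¹ * limUnder (𝓝[<] (1 : ℝ))
      fun s : ℝ => ∑' n, (-s) ^ n * (crossCoeff ν ρ C E r n).toReal,
    JInhom ν ρ O C E northPole, fun r _ hR y => ?_, ?_, ?_, ?_⟩
  · have h1 := tendsto_nhds_unique (hIRWMI.tendsto_momentSeries hX hE hO hR y)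
      (hIRWMI.tendsto_momentSeries hX hE hO hR northPole)
    linarith
  · rintro r - ⟨y₀, h₀⟩ y
    refine ⟨hJd y₀ y r h₀, ?_⟩
    unfold JInhom
    rw [hJs y northPole]
  · filter_upwards [hIRWMI.ae_expectedEsymm_palm hX hQ hO C hE] with y hy r _ hR hcase
    have hfin : ∀ s ∈ Set.Ioo (0 : ℝ) 1,
        ∑' n, ENNReal.ofReal (s ^ n) * crossCoeff ν ρ C E r n ≠ ∞ := by
      rcases hcase with ⟨y', hJ⟩ | hS
      · exact (hIRWMI.crossSeries_eq_mul hX hE hO hC_fin hR hJ).1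
      · exact fun s hs => tsum_ofReal_pow_mul_ne_top (hIRWMI.tsum_crossCoeff_ne_top hC_fin hS) hs
    rw [DInhom,
      (tendsto_crossSeries hE hIRWMI.measurable_rho hC_fin (hy r) hfin).limUnder_eq]
  · rintro r - hR ⟨y₀, h₀⟩ hF
    -- The Abel limit that defines `D` is `ν(C) J(r) (1 - F(r))`, so only a division remains.
    have hlim := (hIRWMI.crossSeries_eq_mul hX hE hO hC_fin hR (hJd y₀ northPole r h₀)).2
    have hF' : 1 - FInhom P X ρ E northPole r ≠ 0 := sub_ne_zero.2 hF.symm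
    simp only [hlim.limUnder_eq, sub_sub_cancel, JInhom]
    rw [eq_div_iff hF', mul_assoc]
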